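/- **Setting.** Let $T=2^K$ with $K\ge 1$, and let $D\ge 1$. In the $N$-experts problem with switching cost $D$, an oblivious adversary fixes loss vectors $l_1,\dots,l_T\in[0,1]^N$; in round $t$ a (randomized) algorithm picks an expert $i_t\in\{1,\dots,N\}$ depending only on its randomness and on $l_1,\dots,l_{t-1}$. For an interval $I=\{t_0+1,\dots,t_0+k\}\subseteq[T]=\{1,\dots,T\}$, the cost of an algorithm $\mathcal A$ on $I$ is $$L_I(\mathcal A)=\mathbb E\Big[\sum_{t\in I} l_t(i_t)+D\sum_{t\in I\setminus\{t_0+1\}}\mathbf 1[i_t\ne i_{t-1}]\Big],$$ and the regret of $\mathcal A$ with respect to an algorithm $\mathcal A'$ on $I$ is at most $R$ if $L_I(\mathcal A)\le L_I(\mathcal A')+R$ for every loss sequence. **Theorem.** There are a universal constant $C$ and a single randomized procedure (the same for all $K,D,N$, all algorithms and all losses; it knows $T$ and $D$) which combines any experts algorithms $\mathcal A_{\mathrm{base}},\mathcal A_0,\dots,\mathcal A_{\log_2 T}$ for the $N$-experts problem with switching cost $D$ and horizon $T$ (run on a common probability space, independently of the procedure's own randomness) into one experts algorithm $\mathcal A$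 as follows. Before each round the procedure specifies one of the algorithms $\mathcal A_{\mathrm{base}},\mathcal A_0,\dots,\mathcal A_{\log_2 T}$, and $\mathcal A$ plays the expert chosen by that algorithm; at the end of each round the only input of the procedure is the loss incurred in that round by the expert chosen by each of these algorithms, and an indication of which of these algorithms switched experts when entering that round. Moreover: 1. For every $0\le u\le\log_2 T$ and every interval $I\subseteq[T]$ with $\frac{T}{2^{u+1}}\le|I|\le\frac{T}{2^u}$, the regret of $\mathcal A$ with respect to $\mathcal A_u$ on $I$ is at most $C\,D\sqrt{|I|\log T}$. 2. The regret of $\mathcal A$ with respect to $\mathcal A_{\mathrm{base}}$ on $[T]$ is at most $D$. 3. The computational overhead of the procedure (on top of running the given algorithms) is at most $C\log T$ steps in every round, and at most $C\log T$ steps of initialization before the first round. Here steps are counted on a real random access machine on which an arithmetic operation, a comparison, a memory access, an exponentiation, an evaluation of the error function $\mathrm{erf}(x)=\int_0^x e^{-s^2/2}\,ds$, and drawing a uniform sample from $[0,1]$ each cost one step. -/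

import Mathlib

open MeasureTheory

/-! ## Experts with switching costs

Rounds are numbered `0, 1, …, T - 1`.  The interval with `k` rounds that starts at round `t₀` is
`Finset.Ico t₀ (t₀ + k)`.  A loss sequence is a map `l`, where `l t i` is the loss of expert `i` in
round `t`; it is fixed before the game starts (oblivious adversary). -/

/-- A randomized online algorithm for the problem with `N` experts.  The sample space `Ω` carries
its randomness.  In round `t` it picks an expert as a function of its randomness and of the loss
vectors of the rounds `0, …, t - 1`. -/
structure ExpertAlg (N : ℕ) (Ω : Type*) [MeasurableSpace Ω] where
  act : (t : ℕ) → (Fin t → Fin N → ℝ) → Ω → Fin N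
  measurable_act : ∀ (t : ℕ) (past : Fin t → Fin N → ℝ), Measurable (act t past)

/-- The expert chosen in round `t` when the algorithm runs on the loss sequence `l`. -/
def ExpertAlg.play {N : ℕ} {Ω : Type*} [MeasurableSpace Ω] (A : ExpertAlg N Ω)
    (l : ℕ → Fin N → ℝ) (ω : Ω) (t : ℕ) : Fin N :=
  A.act t (fun s => l s) ω

/-- The loss of the sequence of choices `a` on the interval of `k` rounds starting at `t₀`: the
losses in these rounds, plus `D` for every switch inside the interval (moving into its first round
is free). -/
noncomputable def intervalCost {N : ℕ} (D : ℝ) (l : ℕ → Fin N → ℝ) (a : ℕ → Fin N)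
    (t₀ k : ℕ) : ℝ :=
  ∑ t ∈ Finset.Ico t₀ (t₀ + k), l t (a t) +
    D * ∑ t ∈ Finset.Ico (t₀ + 1) (t₀ + k), (if a t ≠ a (t - 1) then 1 else 0)

/-- The expected loss, switching costs included, of `A` on an interval. -/
noncomputable def ExpertAlg.expectedCost {N : ℕ} {Ω : Type*} [MeasurableSpace Ω]
    (A : ExpertAlg N Ω) (P : Measure Ω) (D : ℝ) (l : ℕ → Fin N → ℝ) (t₀ k : ℕ) : ℝ :=
  ∫ ω, intervalCost D l (A.play l ω) t₀ k ∂P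

/-! ## A real random access machine

Programs work on arrays of real numbers, addressed by natural-number registers.  Each arithmetic
operation, exponentiation, evaluation of the error function, comparison, memory access and
uniform sample from `[0, 1]` costs one step. -/

namespace RealRAM

/-- Memory: real cells (array number, position), index registers, and the number of uniform
samples that were drawn so far. -/
structure Config where
  real : ℕ → ℕ → ℝ
  index : ℕ → ℕ
  drawn : ℕ

/-- The error function, in the normalization `∫₀ˣ exp (-s² / 2) ds`. -/
noncomputable def erf (x : ℝ) : ℝ := ∫ s in (0 : ℝ)..x, Real.exp (-s ^ 2 / 2)

/-- Index expressions. -/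
inductive IExpr where
  | const (n : ℕ)
  | reg (r : ℕ)
  | add (e₁ e₂ : IExpr)

def IExpr.eval (c : Config) : IExpr → ℕ
  | .const n => n
  | .reg r => c.index r
  | .add e₁ e₂ => e₁.eval c + e₂.eval c

def IExpr.cost : IExpr → ℕ
  | .const _ => 1
  | .reg _ => 1
  | .add e₁ e₂ => 1 + e₁.cost + e₂.cost

/-- Real expressions; `get a i` reads position `i` of array `a`. -/
inductive RExpr where
  | const (q : ℚ)
  | get (a : ℕ) (i : IExpr)
  | ofIndex (i : IExpr)
  | add (e₁ e₂ : RExpr)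
  | sub (e₁ e₂ : RExpr)
  | mul (e₁ e₂ : RExpr)
  | div (e₁ e₂ : RExpr)
  | exp (e : RExpr)
  | pow (e₁ e₂ : RExpr)
  | erf (e : RExpr)

open Classical in
/-- Powers are only computed for a positive base (otherwise the result is `0`). -/
noncomputable def RExpr.eval (c : Config) : RExpr → ℝ
  | .const q => (q : ℝ)
  | .get a i => c.real a (i.eval c)
  | .ofIndex i => (i.eval c : ℝ)
  | .add e₁ e₂ => e₁.eval c + e₂.eval c
  | .sub e₁ e₂ => e₁.eval c - e₂.eval c
  | .mul e₁ e₂ => e₁.eval c * e₂.eval c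
  | .div e₁ e₂ => e₁.eval c / e₂.eval c
  | .exp e => Real.exp (e.eval c)
  | .pow e₁ e₂ => if 0 < e₁.eval c then (e₁.eval c) ^ (e₂.eval c) else 0
  | .erf e => RealRAM.erf (e.eval c)

def RExpr.cost : RExpr → ℕ
  | .const _ => 1
  | .get _ i => 1 + i.cost
  | .ofIndex i => 1 + i.cost
  | .add e₁ e₂ => 1 + e₁.cost + e₂.cost
  | .sub e₁ e₂ => 1 + e₁.cost + e₂.cost
  | .mul e₁ e₂ => 1 + e₁.cost + e₂.cost
  | .div e₁ e₂ => 1 + e₁.cost + e₂.cost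
  | .exp e => 1 + e.cost
  | .pow e₁ e₂ => 1 + e₁.cost + e₂.cost
  | .erf e => 1 + e.cost

/-- Programs. -/
inductive Program where
  | skip
  /-- write the value of `e` to position `i` of array `a` -/
  | setReal (a : ℕ) (i : IExpr) (e : RExpr)
  /-- write the value of `e` to index register `r` -/
  | setIndex (r : ℕ) (e : IExpr)
  /-- write a fresh uniform sample from `[0, 1]` to position `i` of array `a` -/
  | draw (a : ℕ) (i : IExpr)
  | seq (p q : Program)
  /-- if `e₁ ≤ e₂` then `p` else `q` -/
  | ifLe (e₁ e₂ : RExpr) (p q : Program)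
  /-- run `p` for the values `0, …, n - 1` of index register `r`, where `n` is the value of `e`
  before the loop -/
  | forLoop (r : ℕ) (e : IExpr) (p : Program)

def Config.writeReal (c : Config) (a i : ℕ) (x : ℝ) : Config :=
  { c with real := Function.update c.real a (Function.update (c.real a) i x) }

def Config.writeIndex (c : Config) (r n : ℕ) : Config :=
  { c with index := Function.update c.index r n }

/-- `n` rounds of a loop whose round `i` is `body i`; the second components count steps, with one
step charged for the control of each round. -/
def iterate (body : ℕ → Config → Config × ℕ) (c : Config) : ℕ → Config × ℕ
  | 0 => (c, 0)
  | n + 1 =>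
    let before := iterate body c n
    let after := body n before.1
    (after.1, before.2 + 1 + after.2)

open Classical in
/-- Run a program; the result is the final memory and the number of steps.  The `n`-th uniform
sample drawn is `ξ n`. -/
noncomputable def Program.exec (ξ : ℕ → unitInterval) : Program → Config → Config × ℕ
  | .skip, c => (c, 1)
  | .setReal a i e, c => (c.writeReal a (i.eval c) (e.eval c), 1 + i.cost + e.cost)
  | .setIndex r e, c => (c.writeIndex r (e.eval c), 1 + e.cost)
  | .draw a i, c =>
    ({ c.writeReal a (i.eval c) (ξ c.drawn : ℝ) with drawn := c.drawn + 1 }, 1 + i.cost)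
  | .seq p q, c =>
    let c₁ := p.exec ξ c
    let c₂ := q.exec ξ c₁.1
    (c₂.1, c₁.2 + c₂.2)
  | .ifLe e₁ e₂ p q, c =>
    let c₁ := if e₁.eval c ≤ e₂.eval c then p.exec ξ c else q.exec ξ c
    (c₁.1, 1 + e₁.cost + e₂.cost + c₁.2)
  | .forLoop r e p, c =>
    let c₁ := iterate (fun i c' => p.exec ξ (c'.writeIndex r i)) c (e.eval c)
    (c₁.1, 1 + e.cost + c₁.2)

end RealRAM

/-! ## Combining procedures -/

/-- A procedure that combines algorithms: `init` is run once before the first round, `step` is run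
at the end of every round. -/
structure CombiningProcedure where
  init : RealRAM.Program
  step : RealRAM.Program

namespace CombiningProcedure

/-- The memory at the start: index register `0` holds `K`, positions `0` and `1` of array `0` hold
the switching cost `D` and the horizon `T = 2 ^ K`, and everything else is zero. -/
noncomputable def start (K : ℕ) (D : ℝ) : RealRAM.Config where
  real := fun a i => if a = 0 ∧ i = 0 then D else if a = 0 ∧ i = 1 then (2 : ℝ) ^ K else 0
  index := fun r => if r = 0 then K else 0
  drawn := 0

/-- Present the data of a round to the machine: position `j` of array `1` becomes the loss of the
`j`-th algorithm in that round, and position `j` of array `2` becomes `1` if the `j`-th algorithm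
made a switch and `0` otherwise. -/
def feed (loss switched : ℕ → ℝ) (c : RealRAM.Config) : RealRAM.Config :=
  { c with real := fun a i => if a = 1 then loss i else if a = 2 then switched i else c.real a i }

section
variable (proc : CombiningProcedure) (K : ℕ) (D : ℝ) (loss switched : ℕ → ℕ → ℝ)
  (ξ : ℕ → unitInterval)

/-- The memory just before round `t`. -/
noncomputable def memory : ℕ → RealRAM.Config
  | 0 => (proc.init.exec ξ (start K D)).1
  | t + 1 => (proc.step.exec ξ (feed (loss t) (switched t) (memory t))).1

/-- The number of the algorithm that the procedure specifies for round `t`: the content of index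
register `1` just before that round. -/
noncomputable def choice (t : ℕ) : ℕ := (proc.memory K D loss switched ξ t).index 1

/-- The number of steps spent before the first round. -/
noncomputable def initSteps : ℕ := (proc.init.exec ξ (start K D)).2

/-- The number of steps spent at the end of round `t`. -/
noncomputable def roundSteps (t : ℕ) : ℕ :=
  (proc.step.exec ξ (feed (loss t) (switched t) (proc.memory K D loss switched ξ t))).2

end

end CombiningProcedure

/-- The loss in round `t` of the `j`-th of `m` algorithms that run on `l` (zero if `m ≤ j`). -/
noncomputable def realizedLoss {N m : ℕ} {Ω : Type*} [MeasurableSpace Ω]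
    (algs : Fin m → ExpertAlg N Ω) (l : ℕ → Fin N → ℝ) (ω : Ω) (t j : ℕ) : ℝ :=
  if h : j < m then l t ((algs ⟨j, h⟩).play l ω t) else 0

/-- `1` if the `j`-th of `m` algorithms switches its expert when it moves from round `t - 1` to
round `t`, and `0` otherwise (in particular for `t = 0`, and for `m ≤ j`). -/
noncomputable def realizedSwitch {N m : ℕ} {Ω : Type*} [MeasurableSpace Ω]
    (algs : Fin m → ExpertAlg N Ω) (l : ℕ → Fin N → ℝ) (ω : Ω) (t j : ℕ) : ℝ :=
  if h : j < m then
    (if 0 < t ∧ (algs ⟨j, h⟩).play l ω t ≠ (algs ⟨j, h⟩).play l ω (t - 1) then 1 else 0)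
  else 0

/-- The law of an infinite sequence of independent uniform samples from `[0, 1]`. -/
noncomputable def uniformSeeds : Measure (ℕ → unitInterval) :=
  Measure.infinitePi (fun _ => (volume : Measure unitInterval))

/-! ## The chain of gates

Stage `u` of the chain compares a composite algorithm with the algorithm number `u + 1`.  Its state
is a gate `g u ∈ [δ, 1]`, the probability of preferring the latter.  With a threshold `θ u`, drawn
once, the stage prefers the algorithm number `u + 1` as long as `θ u < g u`. -/

namespace GateChain

/-- `1` if the gate `g` is above the threshold `θ`, and `0` otherwise. -/
noncomputable def flag (θ g : ℝ) : ℝ := if g ≤ θ then 0 else 1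

/-- The number of the algorithm that is followed by the first `u` stages. -/
noncomputable def chosen (θ g : ℕ → ℝ) : ℕ → ℕ
  | 0 => 0
  | u + 1 => if g u ≤ θ u then chosen θ g u else u + 1

/-- An upper bound for the loss with switching cost that the composition of the first `u` stages
incurs in a round.  Here `a j` is this cost for the algorithm number `j`, and `g`, `h` are the
gates in this round and in the previous one. -/
noncomputable def stageCost (D : ℝ) (a θ g h : ℕ → ℝ) : ℕ → ℝ
  | 0 => a 0
  | u + 1 =>
    min ((if g u ≤ θ u then stageCost D a θ g h u else a (u + 1)) +
      D * ((flag (θ u) (g u) - flag (θ u) (h u)) * (flag (θ u) (g u) - flag (θ u) (h u))))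
      (1 + D)

/-- The new value of a gate `g` after a round in which the relative advantage of the algorithm
behind the gate was `b`. -/
noncomputable def gateUpdate (δ η b g : ℝ) : ℝ := max δ (min 1 (g * Real.exp (η * (b - 8 * η))))

/-- The gates in round `t` and in the round before. -/
noncomputable def gatePair (D δ : ℝ) (η : ℕ → ℝ) (a : ℕ → ℕ → ℝ) (θ : ℕ → ℝ) :
    ℕ → (ℕ → ℝ) × (ℕ → ℝ)
  | 0 => (fun _ => δ, fun _ => δ)
  | t + 1 =>
    (fun u => gateUpdate δ (η u)
      ((stageCost D (a t) θ (gatePair D δ η a θ t).1 (gatePair D δ η a θ t).2 u - a t (u + 1)) /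
        (1 + D)) ((gatePair D δ η a θ t).1 u), (gatePair D δ η a θ t).1)

end GateChain

/-! ## The program -/

namespace RealRAM

/-- A bound for the number of steps of a program without loops. -/
def Program.stepBound : Program → ℕ
  | .skip => 1
  | .setReal _ i e => 1 + i.cost + e.cost
  | .setIndex _ e => 1 + e.cost
  | .draw _ i => 1 + i.cost
  | .seq p q => p.stepBound + q.stepBound
  | .ifLe e₁ e₂ p q => 1 + e₁.cost + e₂.cost + (p.stepBound + q.stepBound)
  | .forLoop _ _ _ => 0

def Program.LoopFree : Program → Prop
  | .seq p q => p.LoopFree ∧ q.LoopFree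
  | .ifLe _ _ p q => p.LoopFree ∧ q.LoopFree
  | .forLoop _ _ _ => False
  | _ => True

theorem Program.exec_steps_le (ξ : ℕ → unitInterval) (p : Program) (hp : p.LoopFree)
    (c : Config) : (p.exec ξ c).2 ≤ p.stepBound := by
  induction p generalizing c with
  | skip => simp [exec, stepBound]
  | setReal a i e => simp [exec, stepBound]
  | setIndex r e => simp [exec, stepBound]
  | draw a i => simp [exec, stepBound]
  | seq p q ihp ihq =>
    simp only [exec, stepBound]
    exact add_le_add (ihp hp.1 _) (ihq hp.2 _)
  | ifLe e₁ e₂ p q ihp ihq =>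
    simp only [exec, stepBound]
    split
    · have := ihp hp.1 c
      omega
    · have := ihq hp.2 c
      omega
  | forLoop r e p ih => exact hp.elim

theorem iterate_steps_le (body : ℕ → Config → Config × ℕ) (B : ℕ)
    (h : ∀ i c, (body i c).2 ≤ B) (c : Config) (n : ℕ) : (iterate body c n).2 ≤ n * (1 + B) := by
  induction n with
  | zero => simp [iterate]
  | succ n ih =>
    simp only [iterate]
    have := h n (iterate body c n).1
    rw [add_mul]
    omega

/-- Write the value of `x` if `e₁ ≤ e₂`, and the value of `y` otherwise. -/
def Program.setRealIf (e₁ e₂ : RExpr) (a : ℕ) (i : IExpr) (x y : RExpr) : Program :=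
  .ifLe e₁ e₂ (.setReal a i x) (.setReal a i y)

def Program.setIndexIf (e₁ e₂ : RExpr) (r : ℕ) (x y : IExpr) : Program :=
  .ifLe e₁ e₂ (.setIndex r x) (.setIndex r y)

open Classical in
theorem Program.exec_setRealIf (ξ : ℕ → unitInterval) (e₁ e₂ : RExpr) (a : ℕ) (i : IExpr)
    (x y : RExpr) (c : Config) :
    ((Program.setRealIf e₁ e₂ a i x y).exec ξ c).1 =
      c.writeReal a (i.eval c) (if e₁.eval c ≤ e₂.eval c then x.eval c else y.eval c) := by
  simp only [setRealIf, exec]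
  split <;> rfl

open Classical in
theorem Program.exec_setIndexIf (ξ : ℕ → unitInterval) (e₁ e₂ : RExpr) (r : ℕ)
    (x y : IExpr) (c : Config) :
    ((Program.setIndexIf e₁ e₂ r x y).exec ξ c).1 =
      c.writeIndex r (if e₁.eval c ≤ e₂.eval c then x.eval c else y.eval c) := by
  simp only [setIndexIf, exec]
  split <;> rfl

theorem Program.exec_seq (ξ : ℕ → unitInterval) (p q : Program) (c : Config) :
    ((Program.seq p q).exec ξ c).1 = (q.exec ξ (p.exec ξ c).1).1 := rfl

theorem Program.exec_setReal (ξ : ℕ → unitInterval) (a : ℕ) (i : IExpr) (e : RExpr) (c : Config) :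
    ((Program.setReal a i e).exec ξ c).1 = c.writeReal a (i.eval c) (e.eval c) := rfl

theorem Program.exec_setIndex (ξ : ℕ → unitInterval) (r : ℕ) (e : IExpr) (c : Config) :
    ((Program.setIndex r e).exec ξ c).1 = c.writeIndex r (e.eval c) := rfl

end RealRAM

namespace GateChain

open RealRAM

/-- The initialization of stage `u`, where `u` is the content of index register `2`. -/
def initBody : Program :=
  .seq (.draw 3 (.reg 2)) <|
  .seq (.setReal 4 (.reg 2) (.get 0 (.const 6))) <|
  .seq (.setRealIf (.get 4 (.reg 2)) (.get 3 (.reg 2)) 5 (.reg 2) (.const 0) (.const 1)) <|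
  .seq (.setReal 6 (.reg 2) (.div (.const 1) (.add (.const 8)
    (.pow (.div (.get 0 (.const 1)) (.mul (.ofIndex (.reg 0)) (.pow (.const 2) (.ofIndex (.reg 2)))))
      (.const (1 / 2)))))) <|
  .setIndexIf (.get 4 (.reg 2)) (.get 3 (.reg 2)) 1 (.reg 1) (.add (.reg 2) (.const 1))

/-- The update of stage `u`, where `u` is the content of index register `2`. -/
def stepBody : Program :=
  .seq (.setReal 0 (.const 3) (.add (.get 1 (.add (.reg 2) (.const 1)))
    (.mul (.get 0 (.const 0)) (.get 2 (.add (.reg 2) (.const 1)))))) <|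
  .seq (.setRealIf (.get 4 (.reg 2)) (.get 3 (.reg 2)) 0 (.const 4) (.get 0 (.const 2))
    (.get 0 (.const 3))) <|
  .seq (.setRealIf (.get 4 (.reg 2)) (.get 3 (.reg 2)) 0 (.const 5) (.const 0) (.const 1)) <|
  .seq (.setReal 0 (.const 4) (.add (.get 0 (.const 4)) (.mul (.get 0 (.const 0))
    (.mul (.sub (.get 0 (.const 5)) (.get 5 (.reg 2)))
      (.sub (.get 0 (.const 5)) (.get 5 (.reg 2))))))) <|
  .seq (.setReal 5 (.reg 2) (.get 0 (.const 5))) <|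
  .seq (.setReal 4 (.reg 2) (.mul (.get 4 (.reg 2)) (.exp (.mul (.get 6 (.reg 2))
    (.sub (.div (.sub (.get 0 (.const 2)) (.get 0 (.const 3))) (.add (.const 1) (.get 0 (.const 0))))
      (.mul (.const 8) (.get 6 (.reg 2)))))))) <|
  .seq (.setRealIf (.const 1) (.get 4 (.reg 2)) 4 (.reg 2) (.const 1) (.get 4 (.reg 2))) <|
  .seq (.setRealIf (.get 0 (.const 6)) (.get 4 (.reg 2)) 4 (.reg 2) (.get 4 (.reg 2))
    (.get 0 (.const 6))) <|
  .seq (.setRealIf (.get 0 (.const 4)) (.add (.const 1) (.get 0 (.const 0))) 0 (.const 2)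
    (.get 0 (.const 4)) (.add (.const 1) (.get 0 (.const 0)))) <|
  .setIndexIf (.get 4 (.reg 2)) (.get 3 (.reg 2)) 1 (.reg 1) (.add (.reg 2) (.const 1))

/-- The combining procedure. -/
def procedure : CombiningProcedure where
  init := .seq (.setReal 0 (.const 6) (.div (.const 1) (.mul (.const 4)
      (.mul (.get 0 (.const 1)) (.get 0 (.const 1))))))
    (.forLoop 2 (.add (.reg 0) (.const 1)) initBody)
  step := .seq (.setIndex 1 (.const 0)) <|
    .seq (.setReal 0 (.const 2) (.add (.get 1 (.const 0))
      (.mul (.get 0 (.const 0)) (.get 2 (.const 0))))) <|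
    .forLoop 2 (.add (.reg 0) (.const 1)) stepBody

/-- The initial value of all gates, which is also their lower bound. -/
noncomputable def floorGate (K : ℕ) : ℝ := 1 / (4 * (2 ^ K * 2 ^ K))

/-- The learning rate of stage `u`. -/
noncomputable def rate (K u : ℕ) : ℝ := 1 / (8 + (2 ^ K / (K * 2 ^ u) : ℝ) ^ (1 / 2 : ℝ))

theorem exec_initBody (ξ : ℕ → unitInterval) (c : Config) (K u : ℕ) (hK : 1 ≤ K)
    (h0 : c.index 0 = K) (hu : c.index 2 = u) (hT : c.real 0 1 = 2 ^ K) :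
    let c' := (initBody.exec ξ c).1
    c'.index 0 = K ∧ c'.drawn = c.drawn + 1 ∧
    c'.index 1 = (if c.real 0 6 ≤ ξ c.drawn then c.index 1 else u + 1) ∧
    c'.real 0 = c.real 0 ∧
    c'.real 3 = Function.update (c.real 3) u (ξ c.drawn : ℝ) ∧
    c'.real 4 = Function.update (c.real 4) u (c.real 0 6) ∧
    c'.real 5 = Function.update (c.real 5) u (flag (ξ c.drawn) (c.real 0 6)) ∧
    c'.real 6 = Function.update (c.real 6) u (rate K u) := by
  have hpos : (0 : ℝ) < 2 ^ K / (K * 2 ^ u) := by positivity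
  simp [initBody, Program.exec_setRealIf,
    Program.exec_setIndexIf, Program.exec, Config.writeReal, Config.writeIndex, RExpr.eval,
    IExpr.eval, h0, hu, hT, hpos, flag, rate]

theorem exec_stepBody (ξ : ℕ → unitInterval) (c : Config) (u : ℕ) (hu : c.index 2 = u) :
    let c' := (stepBody.exec ξ c).1
    let a := c.real 1 (u + 1) + c.real 0 0 * c.real 2 (u + 1)
    let s := flag (c.real 3 u) (c.real 4 u)
    let g := gateUpdate (c.real 0 6) (c.real 6 u) ((c.real 0 2 - a) / (1 + c.real 0 0))
      (c.real 4 u)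
    c'.index 0 = c.index 0 ∧
    c'.index 1 = (if g ≤ c.real 3 u then c.index 1 else u + 1) ∧
    c'.real 0 0 = c.real 0 0 ∧ c'.real 0 6 = c.real 0 6 ∧
    c'.real 0 2 = min ((if c.real 4 u ≤ c.real 3 u then c.real 0 2 else a) +
      c.real 0 0 * ((s - c.real 5 u) * (s - c.real 5 u))) (1 + c.real 0 0) ∧
    c'.real 1 = c.real 1 ∧ c'.real 2 = c.real 2 ∧ c'.real 3 = c.real 3 ∧
    c'.real 4 = Function.update (c.real 4) u g ∧
    c'.real 5 = Function.update (c.real 5) u s ∧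
    c'.real 6 = c.real 6 := by
  simp [stepBody, Program.exec_seq, Program.exec_setReal, Program.exec_setRealIf,
    Program.exec_setIndexIf, Config.writeReal, Config.writeIndex, RExpr.eval,
    IExpr.eval, hu, flag, gateUpdate, min_def, max_def]

open RealRAM

theorem stageCost_congr {D : ℝ} {a a' θ θ' g g' h h' : ℕ → ℝ} {n : ℕ}
    (ha : ∀ j ≤ n, a j = a' j) (hθ : ∀ j < n, θ j = θ' j)
    (hg : ∀ j < n, g j = g' j) (hh : ∀ j < n, h j = h' j) :
    stageCost D a θ g h n = stageCost D a' θ' g' h' n := by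
  induction n with
  | zero => exact ha 0 le_rfl
  | succ n ih =>
    simp only [stageCost, ha (n + 1) le_rfl, hθ n n.lt_succ_self, hg n n.lt_succ_self,
      hh n n.lt_succ_self, ih (fun j hj => ha j (hj.trans n.le_succ))
      (fun j hj => hθ j (hj.trans n.lt_succ_self)) (fun j hj => hg j (hj.trans n.lt_succ_self))
      (fun j hj => hh j (hj.trans n.lt_succ_self))]

theorem chosen_le (θ g : ℕ → ℝ) (n : ℕ) : chosen θ g n ≤ n := by
  induction n with
  | zero => rfl
  | succ n ih => simp only [chosen]; split <;> omega

theorem _root_.RealRAM.Config.real_writeIndex (c : Config) (r n : ℕ) :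
    (c.writeIndex r n).real = c.real := rfl

theorem _root_.RealRAM.Config.drawn_writeIndex (c : Config) (r n : ℕ) :
    (c.writeIndex r n).drawn = c.drawn := rfl

theorem _root_.RealRAM.Config.index_writeIndex_of_ne (c : Config) {r r' n : ℕ} (h : r' ≠ r) :
    (c.writeIndex r n).index r' = c.index r' := Function.update_of_ne h _ _

/-- The memory `c` holds the thresholds `θ`, the gates `g` of the coming round and the gates `h` of
the round before. -/
structure Represents (K : ℕ) (D : ℝ) (θ g h : ℕ → ℝ) (c : Config) : Prop where
  index_zero : c.index 0 = K
  index_one : c.index 1 = chosen θ g (K + 1)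
  cost : c.real 0 0 = D
  floor : c.real 0 6 = floorGate K
  threshold : ∀ u ≤ K, c.real 3 u = θ u
  gate : ∀ u ≤ K, c.real 4 u = g u
  oldFlag : ∀ u ≤ K, c.real 5 u = flag (θ u) (h u)
  rate : ∀ u ≤ K, c.real 6 u = rate K u

theorem represents_init (K : ℕ) (hK : 1 ≤ K) (D : ℝ) (ξ : ℕ → unitInterval) :
    Represents K D (fun j => ξ j) (fun _ => floorGate K) (fun _ => floorGate K)
      (procedure.init.exec ξ (CombiningProcedure.start K D)).1 := by
  set c₀ := ((Program.setReal 0 (.const 6) (.div (.const 1) (.mul (.const 4)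
      (.mul (.get 0 (.const 1)) (.get 0 (.const 1)))))).exec ξ
      (CombiningProcedure.start K D)).1 with hc₀
  have h0 : c₀.index 0 = K := by
    simp [hc₀, Program.exec_setReal, Config.writeReal, CombiningProcedure.start]
  have h1 : c₀.index 1 = 0 := by
    simp [hc₀, Program.exec_setReal, Config.writeReal, CombiningProcedure.start]
  have hd : c₀.drawn = 0 := by
    simp [hc₀, Program.exec_setReal, Config.writeReal, CombiningProcedure.start]
  have hD : c₀.real 0 0 = D := by
    simp [hc₀, Program.exec_setReal, Config.writeReal, CombiningProcedure.start, IExpr.eval]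
  have hT : c₀.real 0 1 = 2 ^ K := by
    simp [hc₀, Program.exec_setReal, Config.writeReal, CombiningProcedure.start, IExpr.eval]
  have h6 : c₀.real 0 6 = floorGate K := by
    simp [hc₀, Program.exec_setReal, Config.writeReal, CombiningProcedure.start, IExpr.eval,
      RExpr.eval, floorGate]
  have key : ∀ n : ℕ, let c := (iterate (fun i c' => initBody.exec ξ (c'.writeIndex 2 i)) c₀ n).1
      c.index 0 = K ∧ c.drawn = n ∧
      c.index 1 = chosen (fun j => ξ j) (fun _ => floorGate K) n ∧ c.real 0 = c₀.real 0 ∧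
      (∀ u < n, c.real 3 u = ξ u) ∧ (∀ u < n, c.real 4 u = floorGate K) ∧
      (∀ u < n, c.real 5 u = flag (ξ u) (floorGate K)) ∧
      (∀ u < n, c.real 6 u = GateChain.rate K u) := by
    intro n
    induction n with
    | zero => simp [iterate, h0, hd, h1, chosen]
    | succ n ih =>
      obtain ⟨i0, i1, i2, i3, i4, i5, i6, i7⟩ := ih
      simp only [iterate]
      set c := (iterate (fun i c' => initBody.exec ξ (c'.writeIndex 2 i)) c₀ n).1
      obtain ⟨j0, j1, j2, j3, j4, j5, j6, j7⟩ := exec_initBody ξ (c.writeIndex 2 n) K n hK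
        (by simpa [Config.writeIndex] using i0) (by simp [Config.writeIndex])
        (by simpa [Config.writeIndex, i3] using hT)
      simp only [Config.real_writeIndex, Config.drawn_writeIndex, i1, i3, h6] at j1 j2 j3 j4 j5 j6 j7
      refine ⟨j0, j1, ?_, j3, ?_, ?_, ?_, ?_⟩
      · rw [j2, Config.index_writeIndex_of_ne _ (by norm_num), i2]
        rfl
      all_goals
        intro u hu
        simp only [j4, j5, j6, j7, Function.update_apply]
        split_ifs with hun
        · simp only [hun]
        · first | apply i4 | apply i5 | apply i6 | apply i7
          omega
  obtain ⟨i0, i1, i2, i3, i4, i5, i6, i7⟩ := key (K + 1)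
  have hex : (procedure.init.exec ξ (CombiningProcedure.start K D)).1 =
      (iterate (fun i c' => initBody.exec ξ (c'.writeIndex 2 i)) c₀ (K + 1)).1 := by
    conv_rhs => rw [← h0]
    rfl
  rw [hex]
  exact ⟨i0, i2, by rw [i3, hD], by rw [i3, h6], fun u hu => i4 u (by omega),
    fun u hu => i5 u (by omega), fun u hu => i6 u (by omega), fun u hu => i7 u (by omega)⟩

theorem Represents.step {K : ℕ} {D : ℝ} {θ g h : ℕ → ℝ} {c : Config}
    (hc : Represents K D θ g h c) (ξ : ℕ → unitInterval) (loss switched : ℕ → ℝ) :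
    Represents K D θ
      (fun u => gateUpdate (floorGate K) (GateChain.rate K u)
        ((stageCost D (fun j => loss j + D * switched j) θ g h u -
          (loss (u + 1) + D * switched (u + 1))) / (1 + D)) (g u)) g
      (procedure.step.exec ξ (CombiningProcedure.feed loss switched c)).1 := by
  set g' : ℕ → ℝ := fun u => gateUpdate (floorGate K) (GateChain.rate K u)
        ((stageCost D (fun j => loss j + D * switched j) θ g h u -
          (loss (u + 1) + D * switched (u + 1))) / (1 + D)) (g u) with hg'
  set c₀ := ((Program.setReal 0 (.const 2) (.add (.get 1 (.const 0))
      (.mul (.get 0 (.const 0)) (.get 2 (.const 0))))).exec ξ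
      ((Program.setIndex 1 (.const 0)).exec ξ (CombiningProcedure.feed loss switched c)).1).1
    with hc₀
  have h0 : c₀.index 0 = K := by
    simp [hc₀, Program.exec_setReal, Program.exec_setIndex, Config.writeReal, Config.writeIndex,
      CombiningProcedure.feed, hc.index_zero]
  have h1 : c₀.index 1 = 0 := by
    simp [hc₀, Program.exec_setReal, Program.exec_setIndex, Config.writeReal, Config.writeIndex,
      CombiningProcedure.feed, IExpr.eval]
  have hr1 : c₀.real 1 = loss := by
    simp [hc₀, Program.exec_setReal, Program.exec_setIndex, Config.writeReal, Config.writeIndex,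
      CombiningProcedure.feed]
  have hr2 : c₀.real 2 = switched := by
    simp [hc₀, Program.exec_setReal, Program.exec_setIndex, Config.writeReal, Config.writeIndex,
      CombiningProcedure.feed]
  have hr : ∀ i, 3 ≤ i → c₀.real i = c.real i := by
    intro i hi
    simp only [hc₀, Program.exec_setReal, Program.exec_setIndex, Config.writeReal,
      Config.writeIndex, CombiningProcedure.feed, Function.update_apply]
    simp only [show i ≠ 0 by omega, show i ≠ 1 by omega, show i ≠ 2 by omega, if_false]
  have hD : c₀.real 0 0 = D := by
    simp [hc₀, Program.exec_setReal, Program.exec_setIndex, Config.writeReal, Config.writeIndex,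
      CombiningProcedure.feed, IExpr.eval, hc.cost]
  have hf : c₀.real 0 6 = floorGate K := by
    simp [hc₀, Program.exec_setReal, Program.exec_setIndex, Config.writeReal, Config.writeIndex,
      CombiningProcedure.feed, IExpr.eval, hc.floor]
  have h2 : c₀.real 0 2 = loss 0 + D * switched 0 := by
    simp [hc₀, Program.exec_setReal, Program.exec_setIndex, Config.writeReal, Config.writeIndex,
      CombiningProcedure.feed, IExpr.eval, hc.cost, RExpr.eval]
  have key : ∀ n ≤ K + 1,
      let c' := (iterate (fun i c' => stepBody.exec ξ (c'.writeIndex 2 i)) c₀ n).1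
      c'.index 0 = K ∧ c'.index 1 = chosen θ g' n ∧ c'.real 0 0 = D ∧
      c'.real 0 6 = floorGate K ∧
      c'.real 0 2 = stageCost D (fun j => loss j + D * switched j) θ g h n ∧
      c'.real 1 = loss ∧ c'.real 2 = switched ∧ c'.real 3 = c.real 3 ∧ c'.real 6 = c.real 6 ∧
      (∀ u, c'.real 4 u = if u < n then g' u else c.real 4 u) ∧
      (∀ u, c'.real 5 u = if u < n then flag (θ u) (g u) else c.real 5 u) := by
    intro n hn
    induction n with
    | zero =>
      simp [iterate, h0, h1, hD, hf, h2, hr1, hr2, hr 3 le_rfl, hr 4 (by norm_num),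
        hr 5 (by norm_num), hr 6 (by norm_num), chosen, stageCost]
    | succ n ih =>
      obtain ⟨i0, i1, i2, i3, i4, i5, i6, i7, i8, i9, i10⟩ := ih (by omega)
      simp only [iterate]
      set c' := (iterate (fun i c' => stepBody.exec ξ (c'.writeIndex 2 i)) c₀ n).1
      obtain ⟨j0, j1, j2, j3, j4, j5, j6, j7, j8, j9, j10⟩ :=
        exec_stepBody ξ (c'.writeIndex 2 n) n (by simp [Config.writeIndex])
      have hg4 : c'.real 4 n = g n := by simp [i9, hc.gate n (by omega)]
      have hg5 : c'.real 5 n = flag (θ n) (h n) := by simp [i10, hc.oldFlag n (by omega)]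
      have hg3 : c.real 3 n = θ n := hc.threshold n (by omega)
      have hg6 : c.real 6 n = GateChain.rate K n := hc.rate n (by omega)
      simp only [Config.real_writeIndex, i2, i3, i4, i5, i6, i7, i8, hg4, hg5, hg3,
        hg6] at j0 j1 j2 j3 j4 j5 j6 j7 j8 j9 j10
      refine ⟨?_, ?_, j2, j3, ?_, j5, j6, j7, j10, ?_, ?_⟩
      · exact j0.trans (by simpa [Config.writeIndex] using i0)
      · rw [j1, Config.index_writeIndex_of_ne _ (by norm_num), i1]
        rfl
      · exact j4
      · intro u
        simp only [j8, Function.update_apply]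
        by_cases hu : u = n
        · simp [hu, hg']
        · simp only [hu, if_false, i9, show u < n + 1 ↔ u < n by omega]
      · intro u
        simp only [j9, Function.update_apply]
        by_cases hu : u = n
        · simp [hu]
        · simp only [hu, if_false, i10, show u < n + 1 ↔ u < n by omega]
  obtain ⟨i0, i1, i2, i3, i4, i5, i6, i7, i8, i9, i10⟩ := key (K + 1) le_rfl
  have hex : (procedure.step.exec ξ (CombiningProcedure.feed loss switched c)).1 =
      (iterate (fun i c' => stepBody.exec ξ (c'.writeIndex 2 i)) c₀ (K + 1)).1 := by
    conv_rhs => rw [← h0]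
    rfl
  rw [hex]
  refine ⟨i0, i1, i2, i3, fun u hu => by rw [i7, hc.threshold u hu], fun u hu => ?_,
    fun u hu => ?_, fun u hu => by rw [i8, hc.rate u hu]⟩
  · rw [i9, if_pos (by omega)]
  · rw [i10, if_pos (by omega)]

theorem represents_memory (K : ℕ) (hK : 1 ≤ K) (D : ℝ) (loss switched : ℕ → ℕ → ℝ)
    (ξ : ℕ → unitInterval) (t : ℕ) :
    Represents K D (fun j => ξ j)
      (gatePair D (floorGate K) (rate K) (fun s j => loss s j + D * switched s j)
        (fun j => ξ j) t).1
      (gatePair D (floorGate K) (rate K) (fun s j => loss s j + D * switched s j)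
        (fun j => ξ j) t).2
      (procedure.memory K D loss switched ξ t) := by
  induction t with
  | zero => exact represents_init K hK D ξ
  | succ t ih => exact ih.step ξ (loss t) (switched t)

theorem initSteps_le (K : ℕ) (D : ℝ) (ξ : ℕ → unitInterval) :
    procedure.initSteps K D ξ ≤ 100 * (K + 1) := by
  set c₀ := ((Program.setReal 0 (.const 6) (.div (.const 1) (.mul (.const 4)
      (.mul (.get 0 (.const 1)) (.get 0 (.const 1)))))).exec ξ
      (CombiningProcedure.start K D)).1 with hc₀
  have h0 : c₀.index 0 = K := by
    simp [hc₀, Program.exec_setReal, Config.writeReal, CombiningProcedure.start]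
  have hb := iterate_steps_le (fun i c' => initBody.exec ξ (c'.writeIndex 2 i)) _
    (fun i c => Program.exec_steps_le ξ initBody
      (by simp [initBody, Program.LoopFree, Program.setRealIf, Program.setIndexIf])
      (c.writeIndex 2 i)) c₀ (K + 1)
  have : procedure.initSteps K D ξ = (1 + 1 + 9) +
      (1 + 3 + (iterate (fun i c' => initBody.exec ξ (c'.writeIndex 2 i)) c₀ (K + 1)).2) := by
    conv_rhs => rw [← h0]
    rfl
  rw [this]
  have hs : initBody.stepBound ≤ 80 := by
    simp [initBody, Program.stepBound, Program.setRealIf, Program.setIndexIf, RExpr.cost,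
      IExpr.cost]
  nlinarith

theorem roundSteps_le (K : ℕ) (hK : 1 ≤ K) (D : ℝ) (loss switched : ℕ → ℕ → ℝ)
    (ξ : ℕ → unitInterval) (t : ℕ) :
    procedure.roundSteps K D loss switched ξ t ≤ 200 * (K + 1) := by
  set c := CombiningProcedure.feed (loss t) (switched t)
    (procedure.memory K D loss switched ξ t) with hc
  set c₀ := ((Program.setReal 0 (.const 2) (.add (.get 1 (.const 0))
      (.mul (.get 0 (.const 0)) (.get 2 (.const 0))))).exec ξ
      ((Program.setIndex 1 (.const 0)).exec ξ c).1).1 with hc₀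
  have h0 : c₀.index 0 = K := by
    simp [hc₀, hc, Program.exec_setReal, Program.exec_setIndex, Config.writeReal,
      Config.writeIndex, CombiningProcedure.feed,
      (represents_memory K hK D loss switched ξ t).index_zero]
  have hb := iterate_steps_le (fun i c' => stepBody.exec ξ (c'.writeIndex 2 i)) _
    (fun i c => Program.exec_steps_le ξ stepBody
      (by simp [stepBody, Program.LoopFree, Program.setRealIf, Program.setIndexIf])
      (c.writeIndex 2 i)) c₀ (K + 1)
  have : procedure.roundSteps K D loss switched ξ t = 2 + ((1 + 1 + 8) +
      (1 + 3 + (iterate (fun i c' => stepBody.exec ξ (c'.writeIndex 2 i)) c₀ (K + 1)).2)) := by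
    conv_rhs => rw [← h0]
    rfl
  rw [this]
  have hs : stepBody.stepBound ≤ 180 := by
    simp [stepBody, Program.stepBound, Program.setRealIf, Program.setIndexIf, RExpr.cost,
      IExpr.cost]
  nlinarith

end GateChain

/-! ## Analysis of a single gate -/

namespace GateChain

section gateUpdate

variable {δ η b g : ℝ}

theorem floor_le_gateUpdate : δ ≤ gateUpdate δ η b g := le_max_left _ _

theorem gateUpdate_le_one (hδ : δ ≤ 1) : gateUpdate δ η b g ≤ 1 :=
  max_le hδ (min_le_left _ _)

theorem abs_exponent_le (hη : 0 < η) (hη8 : η ≤ 1 / 8) (hb : |b| ≤ 1) :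
    |η * (b - 8 * η)| ≤ 2 * η := by
  rw [abs_mul, abs_of_pos hη, mul_comm]
  refine mul_le_mul_of_nonneg_right ?_ hη.le
  rw [abs_le] at *
  constructor <;> linarith [hb.1, hb.2]

theorem gateUpdate_le_mul_exp (hδ : 0 < δ) (hη : 0 < η) (hη8 : η ≤ 1 / 8) (hb : |b| ≤ 1)
    (hg : δ ≤ g) : gateUpdate δ η b g ≤ g * Real.exp (2 * η) := by
  have hg0 : 0 < g := hδ.trans_le hg
  refine max_le ?_ ((min_le_right _ _).trans ?_)
  · nlinarith [Real.add_one_le_exp (2 * η)]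
  · exact mul_le_mul_of_nonneg_left
      (Real.exp_le_exp.2 (abs_le.1 (abs_exponent_le hη hη8 hb)).2) hg0.le

theorem le_gateUpdate_mul_exp (hδ : 0 < δ) (hη : 0 < η) (hη8 : η ≤ 1 / 8) (hb : |b| ≤ 1)
    (hg : δ ≤ g) (hg1 : g ≤ 1) : g ≤ gateUpdate δ η b g * Real.exp (2 * η) := by
  have hg0 : 0 < g := hδ.trans_le hg
  have h : min 1 (g * Real.exp (η * (b - 8 * η))) * Real.exp (2 * η) ≥ g := by
    rw [min_mul_of_nonneg _ _ (Real.exp_pos _).le, mul_assoc, ← Real.exp_add, ge_iff_le, le_min_iff]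
    have h1 : 1 ≤ Real.exp (2 * η) := Real.one_le_exp (by positivity)
    have h2 : 1 ≤ Real.exp (η * (b - 8 * η) + 2 * η) :=
      Real.one_le_exp (by linarith [(abs_le.1 (abs_exponent_le hη hη8 hb)).1])
    constructor <;> nlinarith
  refine h.le.trans ?_
  gcongr
  exact le_max_right _ _

theorem abs_gateUpdate_sub_le (hδ : 0 < δ) (hη : 0 < η) (hη8 : η ≤ 1 / 8) (hb : |b| ≤ 1)
    (hg : δ ≤ g) (hg1 : g ≤ 1) : |gateUpdate δ η b g - g| ≤ 4 * η * gateUpdate δ η b g := by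
  have h1 := gateUpdate_le_mul_exp hδ hη hη8 hb hg
  have h2 := le_gateUpdate_mul_exp hδ hη hη8 hb hg hg1
  have hg0 : 0 < g := hδ.trans_le hg
  have hu0 : 0 < gateUpdate δ η b g := hδ.trans_le floor_le_gateUpdate
  have he : Real.exp (2 * η) ≤ 1 + 4 * η := by
    have := Real.exp_bound_div_one_sub_of_interval' (x := 2 * η) (by positivity) (by linarith)
    refine this.le.trans ?_
    rw [div_le_iff₀ (by linarith)]
    nlinarith
  have he' : 1 - 2 * η ≤ Real.exp (-(2 * η)) := by linarith [Real.add_one_le_exp (-(2 * η))]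
  have h3 : gateUpdate δ η b g * Real.exp (-(2 * η)) ≤ g := by
    rw [Real.exp_neg, ← div_eq_mul_inv, div_le_iff₀ (Real.exp_pos _)]
    exact h1
  rw [abs_le]
  constructor <;> nlinarith

/-- One round of regret with respect to the composition in front of the gate. -/
theorem gate_round_le_base (hδ : 0 < δ) (hη : 0 < η) (hη8 : η ≤ 1 / 8) (hb : |b| ≤ 1)
    (hg : δ ≤ g) : -(g * b) + 4 * η * g ≤ (g - gateUpdate δ η b g) / η + 2 * δ := by
  have hg0 : 0 < g := hδ.trans_le hg
  obtain ⟨hb1, hb2⟩ := abs_le.1 hb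
  have hy := abs_le.1 (abs_exponent_le hη hη8 hb)
  suffices gateUpdate δ η b g ≤ g + η * (g * b) - 4 * η ^ 2 * g + 2 * δ * η by
    rw [← sub_le_iff_le_add, le_div_iff₀ hη]
    nlinarith
  refine max_le ?_ ((min_le_right _ _).trans ?_)
  · have h1 : 0 ≤ 1 - η - 4 * η ^ 2 := by nlinarith
    have h2 : δ * (1 - η - 4 * η ^ 2) ≤ g * (1 + η * b - 4 * η ^ 2) := by
      apply mul_le_mul hg _ h1 hg0.le
      nlinarith
    nlinarith [mul_pos hδ hη]
  · have he : Real.exp (η * (b - 8 * η)) ≤ 1 + η * (b - 8 * η) + (η * (b - 8 * η)) ^ 2 := by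
      have := (abs_le.1 (Real.abs_exp_sub_one_sub_id_le
        (abs_le.2 ⟨by linarith [hy.1], by linarith [hy.2]⟩ : |η * (b - 8 * η)| ≤ 1))).2
      linarith
    have hsq : (η * (b - 8 * η)) ^ 2 ≤ 4 * η ^ 2 := by nlinarith
    have : Real.exp (η * (b - 8 * η)) ≤ 1 + η * b - 4 * η ^ 2 := by nlinarith
    nlinarith [mul_le_mul_of_nonneg_left this hg0.le, mul_pos hδ hη]

/-- One round of regret with respect to the algorithm behind the gate. -/
theorem gate_round_le_expert (hδ : 0 < δ) (hη : 0 < η) (hη8 : η ≤ 1 / 8) (hb : |b| ≤ 1)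
    (hg : δ ≤ g) (hg1 : g ≤ 1) :
    (1 - g) * b + 4 * η * g ≤
      ((Real.log (gateUpdate δ η b g) - gateUpdate δ η b g) - (Real.log g - g)) / η +
        (8 * η + 2 * δ) := by
  have hg0 : 0 < g := hδ.trans_le hg
  have hy := abs_le.1 (abs_exponent_le hη hη8 hb)
  by_cases hc : g * Real.exp (η * (b - 8 * η)) ≤ 1
  · have hlog : Real.log g + η * (b - 8 * η) ≤ Real.log (gateUpdate δ η b g) := by
      rw [← Real.log_exp (η * (b - 8 * η)), ← Real.log_mul hg0.ne' (Real.exp_pos _).ne']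
      refine Real.log_le_log (by positivity) ?_
      exact (le_min hc le_rfl).trans (le_max_right _ _)
    have h1 := gate_round_le_base hδ hη hη8 hb hg
    have h2 : b - 8 * η ≤ (Real.log (gateUpdate δ η b g) - Real.log g) / η := by
      rw [le_div_iff₀ hη]
      linarith
    have h3 : ((Real.log (gateUpdate δ η b g) - gateUpdate δ η b g) - (Real.log g - g)) / η =
        (Real.log (gateUpdate δ η b g) - Real.log g) / η + (g - gateUpdate δ η b g) / η := by
      rw [← add_div]
      ring
    rw [h3]
    linarith
  · have hu : gateUpdate δ η b g = 1 := by
      rw [gateUpdate, min_eq_left (not_le.1 hc).le, max_eq_right (hg.trans hg1)]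
    have hge : 1 - 2 * η ≤ g := by
      have := le_gateUpdate_mul_exp hδ hη hη8 hb hg hg1
      have h1 : 1 < g * Real.exp (2 * η) := (not_le.1 hc).trans_le
        (mul_le_mul_of_nonneg_left (Real.exp_le_exp.2 hy.2) hg0.le)
      have h2 : Real.exp (-(2 * η)) < g := by
        rw [Real.exp_neg, inv_lt_iff_one_lt_mul₀ (Real.exp_pos _), mul_comm]
        linarith
      linarith [Real.add_one_le_exp (-(2 * η))]
    have hψ : 0 ≤ ((Real.log 1 - 1) - (Real.log g - g)) / η := by
      apply div_nonneg _ hη.le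
      rw [Real.log_one]
      linarith [Real.log_le_sub_one_of_pos hg0]
    rw [hu]
    have h1 : (1 - g) * b ≤ 2 * η := by nlinarith [(abs_le.1 hb).2]
    nlinarith

end gateUpdate

section gateSequence

variable {δ η : ℝ} {b g : ℕ → ℝ}

theorem gate_mem (hδ1 : δ ≤ 1) (h0 : g 0 = δ)
    (hs : ∀ t, g (t + 1) = gateUpdate δ η (b t) (g t)) (t : ℕ) : δ ≤ g t ∧ g t ≤ 1 := by
  cases t with
  | zero => simp [h0, hδ1]
  | succ t => exact hs t ▸ ⟨floor_le_gateUpdate, gateUpdate_le_one hδ1⟩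

theorem abs_gate_sub_le (hδ : 0 < δ) (hδ1 : δ ≤ 1) (hη : 0 < η) (hη8 : η ≤ 1 / 8)
    (hb : ∀ t, |b t| ≤ 1) (h0 : g 0 = δ)
    (hs : ∀ t, g (t + 1) = gateUpdate δ η (b t) (g t)) (t : ℕ) :
    |g t - g (t - 1)| ≤ 4 * η * g t := by
  cases t with
  | zero => simp [h0]; positivity
  | succ t =>
    have := gate_mem hδ1 h0 hs t
    rw [Nat.add_sub_cancel, hs t]
    exact abs_gateUpdate_sub_le hδ hη hη8 (hb t) this.1 this.2

theorem sum_gate_le_base (hδ : 0 < δ) (hδ1 : δ ≤ 1) (hη : 0 < η) (hη8 : η ≤ 1 / 8)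
    (hb : ∀ t, |b t| ≤ 1) (h0 : g 0 = δ)
    (hs : ∀ t, g (t + 1) = gateUpdate δ η (b t) (g t)) (t₀ k : ℕ) :
    ∑ t ∈ Finset.Ico t₀ (t₀ + k), (-(g t * b t) + |g t - g (t - 1)|) ≤
      (g t₀ - g (t₀ + k)) / η + 2 * δ * k := by
  induction k with
  | zero => simp
  | succ k ih =>
    rw [← add_assoc, Finset.sum_Ico_succ_top (by omega)]
    have h1 := gate_round_le_base hδ hη hη8 (hb (t₀ + k)) (gate_mem hδ1 h0 hs (t₀ + k)).1
    have h2 := abs_gate_sub_le hδ hδ1 hη hη8 hb h0 hs (t₀ + k)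
    have h3 : (g t₀ - g (t₀ + k + 1)) / η =
        (g t₀ - g (t₀ + k)) / η + (g (t₀ + k) - g (t₀ + k + 1)) / η := by
      rw [← add_div]
      ring
    rw [← hs] at h1
    push_cast
    linarith

theorem sum_gate_le_expert (hδ : 0 < δ) (hδ1 : δ ≤ 1) (hη : 0 < η) (hη8 : η ≤ 1 / 8)
    (hb : ∀ t, |b t| ≤ 1) (h0 : g 0 = δ)
    (hs : ∀ t, g (t + 1) = gateUpdate δ η (b t) (g t)) (t₀ k : ℕ) :
    ∑ t ∈ Finset.Ico t₀ (t₀ + k), ((1 - g t) * b t + |g t - g (t - 1)|) ≤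
      -Real.log δ / η + (8 * η + 2 * δ) * k := by
  have key : ∑ t ∈ Finset.Ico t₀ (t₀ + k), ((1 - g t) * b t + |g t - g (t - 1)|) ≤
      ((Real.log (g (t₀ + k)) - g (t₀ + k)) - (Real.log (g t₀) - g t₀)) / η +
        (8 * η + 2 * δ) * k := by
    induction k with
    | zero => simp
    | succ k ih =>
      rw [← add_assoc, Finset.sum_Ico_succ_top (by omega)]
      have hm := gate_mem hδ1 h0 hs (t₀ + k)
      have h1 := gate_round_le_expert hδ hη hη8 (hb (t₀ + k)) hm.1 hm.2
      have h2 := abs_gate_sub_le hδ hδ1 hη hη8 hb h0 hs (t₀ + k)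
      rw [← hs] at h1
      have h3 : ((Real.log (g (t₀ + k + 1)) - g (t₀ + k + 1)) - (Real.log (g t₀) - g t₀)) / η =
          ((Real.log (g (t₀ + k)) - g (t₀ + k)) - (Real.log (g t₀) - g t₀)) / η +
          ((Real.log (g (t₀ + k + 1)) - g (t₀ + k + 1)) -
            (Real.log (g (t₀ + k)) - g (t₀ + k))) / η := by
        rw [← add_div]
        ring
      push_cast
      linarith
  refine key.trans ?_
  gcongr
  have hm := gate_mem hδ1 h0 hs (t₀ + k)
  have hm0 := gate_mem hδ1 h0 hs t₀
  have h1 := Real.log_le_sub_one_of_pos (hδ.trans_le hm.1)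
  have h2 : Real.log δ - δ ≤ Real.log (g t₀) - g t₀ := by
    have := Real.log_le_sub_one_of_pos (div_pos hδ (hδ.trans_le hm0.1))
    rw [Real.log_div hδ.ne' (hδ.trans_le hm0.1).ne'] at this
    have h4 : δ / g t₀ - 1 ≤ δ - g t₀ := by
      have hp := hδ.trans_le hm0.1
      rw [sub_le_iff_le_add, div_le_iff₀ hp]
      nlinarith [hm0.1, hm0.2]
    linarith
  linarith

end gateSequence

end GateChain

/-! ## Expectations over the thresholds -/

namespace GateChain

theorem measurePreserving_update_uniformSeeds (u : ℕ) :
    MeasurePreserving (fun p : (ℕ → unitInterval) × unitInterval => Function.update p.1 u p.2)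
      (uniformSeeds.prod volume) uniformSeeds := by
  have hm : Measurable
      (fun p : (ℕ → unitInterval) × unitInterval => Function.update p.1 u p.2) := by
    refine measurable_pi_iff.2 fun j => ?_
    by_cases h : j = u
    · subst h
      simpa using measurable_snd
    · simp only [Function.update_of_ne h]
      fun_prop
  refine ⟨hm, Measure.eq_infinitePi _ fun s A hA => ?_⟩
  rw [Measure.map_apply hm (.pi s.countable_toSet fun _ _ => hA _)]
  by_cases hu : u ∈ s
  · have : (fun p : (ℕ → unitInterval) × unitInterval => Function.update p.1 u p.2) ⁻¹'
        (Set.pi s A) = (Set.pi (s.erase u : Finset ℕ) A) ×ˢ A u := by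
      ext ⟨ξ, x⟩
      simp only [Set.mem_preimage, Set.mem_pi, Set.mem_prod, Finset.mem_coe, Finset.mem_erase]
      constructor
      · intro h
        refine ⟨fun i hi => by simpa [hi.1] using h i hi.2, by simpa using h u hu⟩
      · rintro ⟨h1, h2⟩ i hi
        by_cases hiu : i = u
        · subst hiu
          simpa using h2
        · simpa [hiu] using h1 i ⟨hiu, hi⟩
    rw [this, Measure.prod_prod, uniformSeeds, Measure.infinitePi_pi _ (fun i _ => hA i),
      Finset.prod_erase_mul _ _ hu]
  · have : (fun p : (ℕ → unitInterval) × unitInterval => Function.update p.1 u p.2) ⁻¹'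
        (Set.pi s A) = (Set.pi s A) ×ˢ Set.univ := by
      ext ⟨ξ, x⟩
      simp only [Set.mem_preimage, Set.mem_pi, Set.mem_prod, Finset.mem_coe, Set.mem_univ,
        and_true]
      refine forall₂_congr fun i hi => ?_
      rw [Function.update_of_ne (ne_of_mem_of_not_mem hi hu)]
    rw [this, Measure.prod_prod, uniformSeeds, Measure.infinitePi_pi _ (fun i _ => hA i)]
    simp

instance : IsProbabilityMeasure uniformSeeds := by
  unfold uniformSeeds
  infer_instance

theorem integrable_of_measurable_of_mem {X : Type*} [MeasurableSpace X] {μ : Measure X}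
    [IsFiniteMeasure μ] {f : X → ℝ} (hf : Measurable f) {B : ℝ} (hB : ∀ x, f x ∈ Set.Icc 0 B) :
    Integrable f μ :=
  Integrable.of_bound hf.aestronglyMeasurable B
    (.of_forall fun x => by rw [Real.norm_of_nonneg (hB x).1]; exact (hB x).2)

theorem integral_update_uniformSeeds (u : ℕ) {f : (ℕ → unitInterval) → ℝ} (hf : Measurable f)
    {B : ℝ} (hB : ∀ x, f x ∈ Set.Icc 0 B) :
    ∫ ξ, f ξ ∂uniformSeeds =
      ∫ ξ, (∫ x : unitInterval, f (Function.update ξ u x)) ∂uniformSeeds := by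
  have hp := measurePreserving_update_uniformSeeds u
  rw [← hp.map_eq, integral_map hp.measurable.aemeasurable hf.aestronglyMeasurable, hp.map_eq,
    integral_prod]
  exact integrable_of_measurable_of_mem (hf.comp hp.measurable) (fun x => hB _)

theorem flag_mem (θ g : ℝ) : flag θ g ∈ Set.Icc (0 : ℝ) 1 := by
  unfold flag
  split <;> simp

theorem flag_mono (θ : ℝ) : Monotone (flag θ) := by
  intro g h hgh
  unfold flag
  split_ifs <;> linarith

theorem sub_mul_self_flag (θ g h : ℝ) :
    (flag θ g - flag θ h) * (flag θ g - flag θ h) = |flag θ g - flag θ h| := by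
  unfold flag
  split_ifs <;> simp

theorem measurable_flag {X : Type*} [MeasurableSpace X] {θ g : X → ℝ} (hθ : Measurable θ)
    (hg : Measurable g) : Measurable fun x => flag (θ x) (g x) :=
  Measurable.ite (measurableSet_le hg hθ) measurable_const measurable_const

theorem integrable_flag (g : ℝ) : Integrable (fun x : unitInterval => flag x g) volume :=
  integrable_of_measurable_of_mem (measurable_flag measurable_subtype_coe measurable_const)
    (fun _ => flag_mem _ _)

theorem integral_flag {g : ℝ} (h0 : 0 ≤ g) (h1 : g ≤ 1) :
    ∫ x : unitInterval, flag x g = g := by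
  have : (fun x : unitInterval => flag x g) =
      Set.indicator (Set.Iio (⟨g, h0, h1⟩ : unitInterval)) 1 := by
    ext x
    simp only [flag, Set.indicator_apply, Set.mem_Iio, ← Subtype.coe_lt_coe, Pi.one_apply]
    split_ifs <;> first | rfl | (exfalso; linarith)
  rw [this, integral_indicator_one measurableSet_Iio, Measure.real, unitInterval.volume_Iio]
  exact ENNReal.toReal_ofReal h0

theorem integral_abs_flag_sub {g h : ℝ} (hg : g ∈ Set.Icc (0 : ℝ) 1) (hh : h ∈ Set.Icc (0 : ℝ) 1) :
    ∫ x : unitInterval, |flag x g - flag x h| = |g - h| := by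
  wlog hgh : h ≤ g
  · simpa only [abs_sub_comm] using this hh hg (le_of_not_ge hgh)
  · simp_rw [fun x : unitInterval => abs_of_nonneg (sub_nonneg.2 (flag_mono x hgh))]
    rw [integral_sub (integrable_flag g) (integrable_flag h), integral_flag hg.1 hg.2,
      integral_flag hh.1 hh.2, abs_of_nonneg (sub_nonneg.2 hgh)]

/-! ## Properties of the chain -/

section chain

variable {D δ : ℝ} {η : ℕ → ℝ} {a : ℕ → ℕ → ℝ}

theorem stageCost_mem (hD : 0 ≤ D) {a θ g h : ℕ → ℝ} (ha : ∀ j, a j ∈ Set.Icc 0 (1 + D)) (u : ℕ) :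
    stageCost D a θ g h u ∈ Set.Icc 0 (1 + D) := by
  induction u with
  | zero => exact ha 0
  | succ u ih =>
    refine ⟨le_min (add_nonneg ?_ (mul_nonneg hD (mul_self_nonneg _))) (by linarith),
      min_le_right _ _⟩
    split
    exacts [ih.1, (ha _).1]

theorem gatePair_congr {θ θ' : ℕ → ℝ} (t u : ℕ) (h : ∀ j < u, θ j = θ' j) :
    (gatePair D δ η a θ t).1 u = (gatePair D δ η a θ' t).1 u ∧
      (gatePair D δ η a θ t).2 u = (gatePair D δ η a θ' t).2 u := by
  induction t generalizing u with
  | zero => exact ⟨rfl, rfl⟩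
  | succ t ih =>
    refine ⟨?_, (ih u h).1⟩
    simp only [gatePair]
    rw [stageCost_congr (fun _ _ => rfl) h (fun j hj => (ih j fun i hi => h i (hi.trans hj)).1)
      (fun j hj => (ih j fun i hi => h i (hi.trans hj)).2), (ih u h).1]

theorem gatePair_congr_cost {a a' : ℕ → ℕ → ℝ} (θ : ℕ → ℝ) (t : ℕ) (h : ∀ s < t, a s = a' s) :
    gatePair D δ η a θ t = gatePair D δ η a' θ t := by
  induction t with
  | zero => rfl
  | succ t ih =>
    simp only [gatePair, ih fun s hs => h s (hs.trans t.lt_succ_self), h t t.lt_succ_self]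

theorem gatePair_snd (θ : ℕ → ℝ) (t : ℕ) :
    (gatePair D δ η a θ t).2 = (gatePair D δ η a θ (t - 1)).1 := by
  cases t <;> rfl

theorem gatePair_fst_mem (hδ1 : δ ≤ 1) (θ : ℕ → ℝ) (t u : ℕ) :
    δ ≤ (gatePair D δ η a θ t).1 u ∧ (gatePair D δ η a θ t).1 u ≤ 1 := by
  cases t with
  | zero => exact ⟨le_rfl, hδ1⟩
  | succ t => exact ⟨floor_le_gateUpdate, gateUpdate_le_one hδ1⟩

section measurability

variable {X : Type*} [MeasurableSpace X]

theorem measurable_stageCost {a θ g h : X → ℕ → ℝ} (ha : ∀ j, Measurable fun x => a x j)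
    (hθ : ∀ j, Measurable fun x => θ x j) (hg : ∀ j, Measurable fun x => g x j)
    (hh : ∀ j, Measurable fun x => h x j) (u : ℕ) :
    Measurable fun x => stageCost D (a x) (θ x) (g x) (h x) u := by
  induction u with
  | zero => exact ha 0
  | succ u ih =>
    simp only [stageCost]
    have h1 := (measurable_flag (hθ u) (hg u)).sub (measurable_flag (hθ u) (hh u))
    exact ((Measurable.ite (measurableSet_le (hg u) (hθ u)) ih (ha _)).add
      ((h1.mul h1).const_mul D)).min measurable_const

theorem measurable_gatePair {a : X → ℕ → ℕ → ℝ} {θ : X → ℕ → ℝ}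
    (ha : ∀ t j, Measurable fun x => a x t j) (hθ : ∀ j, Measurable fun x => θ x j) (t u : ℕ) :
    Measurable (fun x => (gatePair D δ η (a x) (θ x) t).1 u) ∧
      Measurable (fun x => (gatePair D δ η (a x) (θ x) t).2 u) := by
  induction t generalizing u with
  | zero => exact ⟨measurable_const, measurable_const⟩
  | succ t ih =>
    refine ⟨?_, (ih u).1⟩
    simp only [gatePair, gateUpdate]
    have h1 := ((measurable_stageCost (D := D) (ha t) hθ (fun j => (ih j).1) (fun j => (ih j).2)
      u).sub (ha t (u + 1))).div_const (1 + D)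
    exact measurable_const.max (measurable_const.min ((ih u).1.mul
      ((h1.sub_const (8 * η u)).const_mul (η u)).exp))

theorem measurable_chosen {θ g : X → ℕ → ℝ} (hθ : ∀ j, Measurable fun x => θ x j)
    (hg : ∀ j, Measurable fun x => g x j) (n : ℕ) :
    Measurable fun x => chosen (θ x) (g x) n := by
  induction n with
  | zero => exact measurable_const
  | succ n ih => exact Measurable.ite (measurableSet_le (hg n) (hθ n)) ih measurable_const

end measurability

/-- The cost of the composition of the first `u` stages in round `t`. -/
noncomputable def chainCost (D δ : ℝ) (η : ℕ → ℝ) (a : ℕ → ℕ → ℝ) (t u : ℕ)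
    (ξ : ℕ → unitInterval) : ℝ :=
  stageCost D (a t) (fun j => ξ j) (gatePair D δ η a (fun j => ξ j) t).1
    (gatePair D δ η a (fun j => ξ j) t).2 u

/-- The gate of stage `u` in round `t`. -/
noncomputable def gate (D δ : ℝ) (η : ℕ → ℝ) (a : ℕ → ℕ → ℝ) (t u : ℕ)
    (ξ : ℕ → unitInterval) : ℝ :=
  (gatePair D δ η a (fun j => ξ j) t).1 u

theorem measurable_seed (j : ℕ) : Measurable fun ξ : ℕ → unitInterval => (ξ j : ℝ) :=
  measurable_subtype_coe.comp (measurable_pi_apply j)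

theorem measurable_gate (t u : ℕ) : Measurable (gate D δ η a t u) :=
  (measurable_gatePair (a := fun _ => a) (fun _ _ => measurable_const) measurable_seed t u).1

theorem measurable_chainCost (t u : ℕ) : Measurable (chainCost D δ η a t u) :=
  have h := measurable_gatePair (D := D) (δ := δ) (η := η) (a := fun _ => a)
    (fun _ _ => measurable_const) measurable_seed t
  measurable_stageCost (a := fun _ => a t) (fun _ => measurable_const) measurable_seed
    (fun j => (h j).1) (fun j => (h j).2) u

theorem chainCost_mem (hD : 0 ≤ D) (ha : ∀ t j, a t j ∈ Set.Icc 0 (1 + D)) (t u : ℕ)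
    (ξ : ℕ → unitInterval) : chainCost D δ η a t u ξ ∈ Set.Icc 0 (1 + D) :=
  stageCost_mem hD (ha t) u

theorem gate_mem_Icc (hδ : 0 ≤ δ) (hδ1 : δ ≤ 1) (t u : ℕ) (ξ : ℕ → unitInterval) :
    gate D δ η a t u ξ ∈ Set.Icc (0 : ℝ) 1 :=
  ⟨hδ.trans (gatePair_fst_mem hδ1 _ t u).1, (gatePair_fst_mem hδ1 _ t u).2⟩

theorem gate_update (t u : ℕ) (ξ : ℕ → unitInterval) (x : unitInterval) :
    gate D δ η a t u (Function.update ξ u x) = gate D δ η a t u ξ :=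
  (gatePair_congr t u fun j hj => by rw [Function.update_of_ne hj.ne]).1

theorem chainCost_update (t u : ℕ) (ξ : ℕ → unitInterval) (x : unitInterval) :
    chainCost D δ η a t u (Function.update ξ u x) = chainCost D δ η a t u ξ := by
  have h : ∀ j < u, ((Function.update ξ u x j : unitInterval) : ℝ) = ξ j := fun j hj => by
    rw [Function.update_of_ne hj.ne]
  exact stageCost_congr (fun _ _ => rfl) h
    (fun j hj => (gatePair_congr t j fun i hi => h i (hi.trans hj)).1)
    (fun j hj => (gatePair_congr t j fun i hi => h i (hi.trans hj)).2)

/-- The expected cost of a stage, given the thresholds of the earlier stages. -/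
noncomputable def mixedCost (D δ : ℝ) (η : ℕ → ℝ) (a : ℕ → ℕ → ℝ) (t u : ℕ)
    (ξ : ℕ → unitInterval) : ℝ :=
  (1 - gate D δ η a t u ξ) * chainCost D δ η a t u ξ + gate D δ η a t u ξ * a t (u + 1) +
    D * |gate D δ η a t u ξ - gate D δ η a (t - 1) u ξ|

theorem chainCost_succ_update_le (t u : ℕ) (ξ : ℕ → unitInterval) (x : unitInterval) :
    chainCost D δ η a t (u + 1) (Function.update ξ u x) ≤
      chainCost D δ η a t u ξ + (a t (u + 1) - chainCost D δ η a t u ξ) *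
        flag x (gate D δ η a t u ξ) +
      D * |flag x (gate D δ η a t u ξ) - flag x (gate D δ η a (t - 1) u ξ)| := by
  have h : chainCost D δ η a t (u + 1) (Function.update ξ u x) ≤
      (if gate D δ η a t u (Function.update ξ u x) ≤ ((Function.update ξ u x) u : unitInterval) then
        chainCost D δ η a t u (Function.update ξ u x) else a t (u + 1)) +
      D * |flag ((Function.update ξ u x) u : unitInterval)
          (gate D δ η a t u (Function.update ξ u x)) -
        flag ((Function.update ξ u x) u : unitInterval)
          (gate D δ η a (t - 1) u (Function.update ξ u x))| := by
    rw [← sub_mul_self_flag, gate, gate, ← gatePair_snd]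
    exact min_le_left _ _
  rw [gate_update, gate_update, chainCost_update, Function.update_self] at h
  refine h.trans_eq ?_
  congr 1
  by_cases hx : gate D δ η a t u ξ ≤ x
  · simp [flag, hx]
  · simp [flag, hx]

theorem integral_chainCost_update_le (hD : 0 ≤ D) (hδ : 0 ≤ δ) (hδ1 : δ ≤ 1)
    (ha : ∀ t j, a t j ∈ Set.Icc 0 (1 + D)) (t u : ℕ) (ξ : ℕ → unitInterval) :
    ∫ x : unitInterval, chainCost D δ η a t (u + 1) (Function.update ξ u x) ≤
      mixedCost D δ η a t u ξ := by
  have hg := gate_mem_Icc (D := D) (η := η) (a := a) hδ hδ1 t u ξ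
  have hg' := gate_mem_Icc (D := D) (η := η) (a := a) hδ hδ1 (t - 1) u ξ
  have i1 : Integrable (fun x : unitInterval => chainCost D δ η a t u ξ +
      (a t (u + 1) - chainCost D δ η a t u ξ) * flag x (gate D δ η a t u ξ)) :=
    (integrable_const _).add ((integrable_flag _).const_mul _)
  have i2 : Integrable (fun x : unitInterval =>
      D * |flag x (gate D δ η a t u ξ) - flag x (gate D δ η a (t - 1) u ξ)|) :=
    ((integrable_flag _).sub (integrable_flag _)).abs.const_mul D
  refine (integral_mono_of_nonneg (.of_forall fun x => (chainCost_mem hD ha t _ _).1)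
    (i1.add i2) (.of_forall fun x => chainCost_succ_update_le t u ξ x)).trans_eq ?_
  simp only [Pi.add_apply]
  rw [integral_add i1 i2, integral_add (integrable_const _) ((integrable_flag _).const_mul _),
    integral_const_mul, integral_const_mul, integral_flag hg.1 hg.2,
    integral_abs_flag_sub hg hg']
  simp only [integral_const, probReal_univ, one_smul, mixedCost]
  ring

theorem integrable_chainCost (hD : 0 ≤ D) (ha : ∀ t j, a t j ∈ Set.Icc 0 (1 + D)) (t u : ℕ) :
    Integrable (chainCost D δ η a t u) uniformSeeds :=
  integrable_of_measurable_of_mem (measurable_chainCost t u) (chainCost_mem hD ha t u)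

theorem integrable_mixedCost (hD : 0 ≤ D) (hδ : 0 ≤ δ) (hδ1 : δ ≤ 1)
    (ha : ∀ t j, a t j ∈ Set.Icc 0 (1 + D)) (t u : ℕ) :
    Integrable (mixedCost D δ η a t u) uniformSeeds := by
  have hm : Measurable (mixedCost D δ η a t u) :=
    (((measurable_const.sub (measurable_gate t u)).mul (measurable_chainCost t u)).add
      ((measurable_gate t u).mul_const _)).add
      (((measurable_gate t u).sub (measurable_gate (t - 1) u)).abs.const_mul D)
  refine integrable_of_measurable_of_mem hm (B := 1 + D + D) fun ξ => ?_
  have hg := gate_mem_Icc (D := D) (η := η) (a := a) hδ hδ1 t u ξ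
  have hg' := gate_mem_Icc (D := D) (η := η) (a := a) hδ hδ1 (t - 1) u ξ
  have hc := chainCost_mem (δ := δ) (η := η) hD ha t u ξ
  have habs : |gate D δ η a t u ξ - gate D δ η a (t - 1) u ξ| ≤ 1 :=
    abs_le.2 ⟨by linarith [hg.1, hg'.2], by linarith [hg.2, hg'.1]⟩
  have h1 := mul_nonneg (sub_nonneg.2 hg.2) hc.1
  have h2 := mul_nonneg hg.1 (ha t (u + 1)).1
  have h3 := mul_le_mul_of_nonneg_left habs hD
  have h4 := mul_nonneg hD (abs_nonneg (gate D δ η a t u ξ - gate D δ η a (t - 1) u ξ))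
  have h5 := mul_le_mul_of_nonneg_left hc.2 (sub_nonneg.2 hg.2)
  have h6 := mul_le_mul_of_nonneg_left (ha t (u + 1)).2 hg.1
  unfold mixedCost
  constructor <;> linarith

theorem integral_sum_chainCost_succ_le (hD : 0 ≤ D) (hδ : 0 ≤ δ) (hδ1 : δ ≤ 1)
    (ha : ∀ t j, a t j ∈ Set.Icc 0 (1 + D)) (u : ℕ) (s : Finset ℕ) :
    ∫ ξ, ∑ t ∈ s, chainCost D δ η a t (u + 1) ξ ∂uniformSeeds ≤
      ∫ ξ, ∑ t ∈ s, mixedCost D δ η a t u ξ ∂uniformSeeds := by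
  rw [integral_finsetSum _ fun t _ => integrable_chainCost hD ha t _,
    integral_finsetSum _ fun t _ => integrable_mixedCost hD hδ hδ1 ha t _]
  refine Finset.sum_le_sum fun t _ => ?_
  rw [integral_update_uniformSeeds u (measurable_chainCost t (u + 1)) (chainCost_mem hD ha t _)]
  exact integral_mono_of_nonneg
    (.of_forall fun ξ => integral_nonneg fun x => (chainCost_mem hD ha t _ _).1)
    (integrable_mixedCost hD hδ hδ1 ha t u)
    (.of_forall fun ξ => integral_chainCost_update_le hD hδ hδ1 ha t u ξ)

/-- The advantage of the algorithm behind gate `u` in round `t`. -/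
noncomputable def advantage (D δ : ℝ) (η : ℕ → ℝ) (a : ℕ → ℕ → ℝ) (u : ℕ)
    (ξ : ℕ → unitInterval) (t : ℕ) : ℝ :=
  (chainCost D δ η a t u ξ - a t (u + 1)) / (1 + D)

theorem abs_advantage_le (hD : 0 ≤ D) (ha : ∀ t j, a t j ∈ Set.Icc 0 (1 + D)) (u : ℕ)
    (ξ : ℕ → unitInterval) (t : ℕ) : |advantage D δ η a u ξ t| ≤ 1 := by
  have hc := chainCost_mem (δ := δ) (η := η) hD ha t u ξ
  have := ha t (u + 1)
  rw [advantage, abs_div, abs_of_pos (by linarith : 0 < 1 + D), div_le_one (by linarith), abs_le]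
  constructor <;> linarith [hc.1, hc.2, this.1, this.2]

theorem mul_advantage (hD : 0 ≤ D) (u : ℕ) (ξ : ℕ → unitInterval) (t : ℕ) :
    (1 + D) * advantage D δ η a u ξ t = chainCost D δ η a t u ξ - a t (u + 1) :=
  mul_div_cancel₀ _ (by positivity)

theorem sum_mixedCost_le_base (hD : 0 ≤ D) (hδ : 0 < δ) (hδ1 : δ ≤ 1) {u : ℕ} (hη : 0 < η u)
    (hη8 : η u ≤ 1 / 8) (ha : ∀ t j, a t j ∈ Set.Icc 0 (1 + D)) (ξ : ℕ → unitInterval)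
    (t₀ k : ℕ) :
    ∑ t ∈ Finset.Ico t₀ (t₀ + k), mixedCost D δ η a t u ξ ≤
      ∑ t ∈ Finset.Ico t₀ (t₀ + k), chainCost D δ η a t u ξ +
        (1 + D) * ((gate D δ η a t₀ u ξ - gate D δ η a (t₀ + k) u ξ) / η u + 2 * δ * k) := by
  have h := sum_gate_le_base hδ hδ1 hη hη8 (abs_advantage_le (δ := δ) (η := η) hD ha u ξ)
    (g := fun t => gate D δ η a t u ξ) rfl (fun t => rfl) t₀ k
  refine le_trans ?_ (add_le_add_right (mul_le_mul_of_nonneg_left h (by positivity)) _)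
  rw [Finset.mul_sum, ← Finset.sum_add_distrib]
  refine Finset.sum_le_sum fun t _ => ?_
  have h1 := mul_advantage (δ := δ) (η := η) (a := a) hD u ξ t
  have h2 := abs_nonneg (gate D δ η a t u ξ - gate D δ η a (t - 1) u ξ)
  have h3 : (1 + D) * (gate D δ η a t u ξ * advantage D δ η a u ξ t) =
    gate D δ η a t u ξ * (chainCost D δ η a t u ξ - a t (u + 1)) := by rw [← h1]; ring
  rw [mul_add, mul_neg, h3, mixedCost]
  linarith

theorem sum_mixedCost_le_expert (hD : 0 ≤ D) (hδ : 0 < δ) (hδ1 : δ ≤ 1) {u : ℕ} (hη : 0 < η u)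
    (hη8 : η u ≤ 1 / 8) (ha : ∀ t j, a t j ∈ Set.Icc 0 (1 + D)) (ξ : ℕ → unitInterval)
    (t₀ k : ℕ) :
    ∑ t ∈ Finset.Ico t₀ (t₀ + k), mixedCost D δ η a t u ξ ≤
      ∑ t ∈ Finset.Ico t₀ (t₀ + k), a t (u + 1) +
        (1 + D) * (-Real.log δ / η u + (8 * η u + 2 * δ) * k) := by
  have h := sum_gate_le_expert hδ hδ1 hη hη8 (abs_advantage_le (δ := δ) (η := η) hD ha u ξ)
    (g := fun t => gate D δ η a t u ξ) rfl (fun t => rfl) t₀ k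
  refine le_trans ?_ (add_le_add_right (mul_le_mul_of_nonneg_left h (by positivity)) _)
  rw [Finset.mul_sum, ← Finset.sum_add_distrib]
  refine Finset.sum_le_sum fun t _ => ?_
  have h1 := mul_advantage (δ := δ) (η := η) (a := a) hD u ξ t
  have h2 := abs_nonneg (gate D δ η a t u ξ - gate D δ η a (t - 1) u ξ)
  have h3 : (1 + D) * ((1 - gate D δ η a t u ξ) * advantage D δ η a u ξ t) =
    (1 - gate D δ η a t u ξ) * (chainCost D δ η a t u ξ - a t (u + 1)) := by rw [← h1]; ring
  rw [mul_add, h3, mixedCost]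
  linarith

theorem integral_sum_chainCost_succ_le_base (hD : 0 ≤ D) (hδ : 0 < δ) (hδ1 : δ ≤ 1) {u : ℕ}
    (hη : 0 < η u) (hη8 : η u ≤ 1 / 8) (ha : ∀ t j, a t j ∈ Set.Icc 0 (1 + D)) (t₀ k : ℕ) {r : ℝ}
    (hr : ∀ ξ, gate D δ η a t₀ u ξ - gate D δ η a (t₀ + k) u ξ ≤ r) :
    ∫ ξ, ∑ t ∈ Finset.Ico t₀ (t₀ + k), chainCost D δ η a t (u + 1) ξ ∂uniformSeeds ≤
      ∫ ξ, ∑ t ∈ Finset.Ico t₀ (t₀ + k), chainCost D δ η a t u ξ ∂uniformSeeds +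
        (1 + D) * (r / η u + 2 * δ * k) := by
  have hi : Integrable (fun ξ => ∑ t ∈ Finset.Ico t₀ (t₀ + k), chainCost D δ η a t u ξ)
    uniformSeeds := integrable_finsetSum _ fun t _ => integrable_chainCost hD ha t u
  calc _ ≤ _ := integral_sum_chainCost_succ_le hD hδ.le hδ1 ha u _
    _ ≤ ∫ ξ, (∑ t ∈ Finset.Ico t₀ (t₀ + k), chainCost D δ η a t u ξ +
        (1 + D) * (r / η u + 2 * δ * k)) ∂uniformSeeds := by
      refine integral_mono (integrable_finsetSum _ fun t _ =>
        integrable_mixedCost hD hδ.le hδ1 ha t u) (hi.add (integrable_const _)) fun ξ => ?_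
      refine (sum_mixedCost_le_base hD hδ hδ1 hη hη8 ha ξ t₀ k).trans ?_
      have := hr ξ
      gcongr
    _ = _ := by
      rw [integral_add hi (integrable_const _)]
      simp

theorem integral_sum_chainCost_succ_le_expert (hD : 0 ≤ D) (hδ : 0 < δ) (hδ1 : δ ≤ 1) {u : ℕ}
    (hη : 0 < η u) (hη8 : η u ≤ 1 / 8) (ha : ∀ t j, a t j ∈ Set.Icc 0 (1 + D)) (t₀ k : ℕ) :
    ∫ ξ, ∑ t ∈ Finset.Ico t₀ (t₀ + k), chainCost D δ η a t (u + 1) ξ ∂uniformSeeds ≤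
      ∑ t ∈ Finset.Ico t₀ (t₀ + k), a t (u + 1) +
        (1 + D) * (-Real.log δ / η u + (8 * η u + 2 * δ) * k) := by
  calc _ ≤ _ := integral_sum_chainCost_succ_le hD hδ.le hδ1 ha u _
    _ ≤ ∫ ξ, (∑ t ∈ Finset.Ico t₀ (t₀ + k), a t (u + 1) +
        (1 + D) * (-Real.log δ / η u + (8 * η u + 2 * δ) * k)) ∂uniformSeeds :=
      integral_mono (integrable_finsetSum _ fun t _ => integrable_mixedCost hD hδ.le hδ1 ha t u)
        (integrable_const _) fun ξ => sum_mixedCost_le_expert hD hδ hδ1 hη hη8 ha ξ t₀ k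
    _ = _ := by simp

/-- From the start, the composition of `n` stages has almost no regret with respect to the base
algorithm. -/
theorem integral_sum_chainCost_le_base (hD : 0 ≤ D) (hδ : 0 < δ) (hδ1 : δ ≤ 1)
    (hη : ∀ u, 0 < η u) (hη8 : ∀ u, η u ≤ 1 / 8) (ha : ∀ t j, a t j ∈ Set.Icc 0 (1 + D))
    (n k : ℕ) :
    ∫ ξ, ∑ t ∈ Finset.Ico 0 (0 + k), chainCost D δ η a t n ξ ∂uniformSeeds ≤
      ∑ t ∈ Finset.Ico 0 (0 + k), a t 0 + n * ((1 + D) * (2 * δ * k)) := by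
  induction n with
  | zero => simp [chainCost, stageCost]
  | succ n ih =>
    have := integral_sum_chainCost_succ_le_base hD hδ hδ1 (hη n) (hη8 n) ha 0 k (r := 0)
      fun ξ => sub_nonpos.2 (gatePair_fst_mem hδ1 _ (0 + k) n).1
    simp only [zero_div, zero_add] at this ih ⊢
    push_cast
    linarith

theorem integral_sum_chainCost_le_expert (hD : 0 ≤ D) (hδ : 0 < δ) (hδ1 : δ ≤ 1)
    (hη : ∀ u, 0 < η u) (hη8 : ∀ u, η u ≤ 1 / 8) (ha : ∀ t j, a t j ∈ Set.Icc 0 (1 + D))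
    (u n t₀ k : ℕ) (hn : u + 1 ≤ n) :
    ∫ ξ, ∑ t ∈ Finset.Ico t₀ (t₀ + k), chainCost D δ η a t n ξ ∂uniformSeeds ≤
      ∑ t ∈ Finset.Ico t₀ (t₀ + k), a t (u + 1) +
        (1 + D) * (-Real.log δ / η u + (8 * η u + 2 * δ) * k +
          ∑ v ∈ Finset.Ico (u + 1) n, (1 / η v + 2 * δ * k)) := by
  induction n, hn using Nat.le_induction with
  | base => simpa using integral_sum_chainCost_succ_le_expert hD hδ hδ1 (hη u) (hη8 u) ha t₀ k
  | succ n hn ih =>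
    have := integral_sum_chainCost_succ_le_base hD hδ hδ1 (hη n) (hη8 n) ha t₀ k (r := 1)
      fun ξ => by
        have h1 := gatePair_fst_mem (D := D) (η := η) (a := a) hδ1 (fun j => ξ j) (t₀ + k) n
        have h2 := gatePair_fst_mem (D := D) (η := η) (a := a) hδ1 (fun j => ξ j) t₀ n
        unfold gate
        linarith
    rw [Finset.sum_Ico_succ_top (by omega), ← add_assoc, mul_add]
    linarith

end chain

end GateChain

/-! ## The combined algorithm -/

namespace GateChain

/-- The costs of the combined algorithms, with every switch charged to the round it leads to. -/
noncomputable def agentCost {N m : ℕ} {Ω : Type*} [MeasurableSpace Ω]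
    (algs : Fin m → ExpertAlg N Ω) (D : ℝ) (l : ℕ → Fin N → ℝ) (ω : Ω) (t j : ℕ) : ℝ :=
  realizedLoss algs l ω t j + D * realizedSwitch algs l ω t j

/-- The cost of the choices `a` in round `t`, with the cost of switching into it. -/
noncomputable def roundCost {N : ℕ} (D : ℝ) (l : ℕ → Fin N → ℝ) (a : ℕ → Fin N) (t : ℕ) : ℝ :=
  l t (a t) + D * (if 0 < t ∧ a t ≠ a (t - 1) then 1 else 0)

section roundCost

variable {N : ℕ} {D : ℝ} {l : ℕ → Fin N → ℝ}

theorem roundCost_mem (hD : 0 ≤ D) (hl : ∀ t i, l t i ∈ Set.Icc (0 : ℝ) 1) (a : ℕ → Fin N)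
    (t : ℕ) : roundCost D l a t ∈ Set.Icc 0 (1 + D) := by
  have := hl t (a t)
  unfold roundCost
  split_ifs <;> constructor <;> linarith [this.1, this.2]

theorem intervalCost_zero_eq (a : ℕ → Fin N) (k : ℕ) :
    intervalCost D l a 0 k = ∑ t ∈ Finset.Ico 0 (0 + k), roundCost D l a t := by
  simp only [intervalCost, roundCost, Finset.sum_add_distrib, Finset.mul_sum]
  congr 1
  rcases Nat.eq_zero_or_pos k with rfl | hk
  · simp
  · rw [Finset.sum_eq_sum_Ico_succ_bot (a := 0) (by omega)]
    simp only [lt_irrefl, false_and, if_false, mul_zero, zero_add]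
    refine Finset.sum_congr rfl fun t ht => ?_
    rw [Finset.mem_Ico] at ht
    simp [show 0 < t by omega]

theorem intervalCost_le_sum_roundCost (hD : 0 ≤ D) (a : ℕ → Fin N) (t₀ k : ℕ) :
    intervalCost D l a t₀ k ≤ ∑ t ∈ Finset.Ico t₀ (t₀ + k), roundCost D l a t := by
  simp only [intervalCost, roundCost, Finset.sum_add_distrib, Finset.mul_sum]
  gcongr
  refine (Finset.sum_le_sum fun t ht => ?_).trans (Finset.sum_le_sum_of_subset_of_nonneg
    (Finset.Ico_subset_Ico_left t₀.le_succ) fun t _ _ => ?_)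
  · rw [Finset.mem_Ico] at ht
    simp [show 0 < t by omega]
  · split_ifs <;> simp [hD]

theorem sum_roundCost_le_intervalCost_add (hD : 0 ≤ D) (a : ℕ → Fin N) (t₀ k : ℕ) :
    ∑ t ∈ Finset.Ico t₀ (t₀ + k), roundCost D l a t ≤ intervalCost D l a t₀ k + D := by
  simp only [intervalCost, roundCost, Finset.sum_add_distrib, Finset.mul_sum, add_assoc]
  gcongr
  rcases Nat.eq_zero_or_pos k with rfl | hk
  · simp [hD]
  · rw [Finset.sum_eq_sum_Ico_succ_bot (a := t₀) (by omega), add_comm]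
    refine add_le_add (Finset.sum_le_sum fun t _ => ?_) ?_
    · gcongr
      split_ifs <;> first | rfl | simp_all
    · split_ifs <;> simp [hD]

theorem intervalCost_mem (hD : 0 ≤ D) (hl : ∀ t i, l t i ∈ Set.Icc (0 : ℝ) 1) (a : ℕ → Fin N)
    (t₀ k : ℕ) : intervalCost D l a t₀ k ∈ Set.Icc 0 (k * (1 + D)) := by
  constructor
  · refine add_nonneg (Finset.sum_nonneg fun t _ => (hl t _).1)
      (mul_nonneg hD (Finset.sum_nonneg fun t _ => ?_))
    split_ifs <;> simp
  · refine (intervalCost_le_sum_roundCost hD a t₀ k).trans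
      ((Finset.sum_le_card_nsmul _ _ _ fun t _ => (roundCost_mem hD hl a t).2).trans_eq ?_)
    simp [mul_add]

theorem measurable_intervalCost {X : Type*} [MeasurableSpace X] {a : X → ℕ → Fin N}
    (ha : ∀ t, Measurable fun x => a x t) (t₀ k : ℕ) :
    Measurable fun x => intervalCost D l (a x) t₀ k := by
  refine Measurable.add (Finset.measurable_fun_sum _ fun t _ =>
    (measurable_of_countable (l t)).comp (ha t))
    ((Finset.measurable_fun_sum _ fun t _ => ?_).const_mul D)
  exact (measurable_of_countable fun p : Fin N × Fin N => if p.1 ≠ p.2 then (1 : ℝ) else 0).comp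
    ((ha t).prodMk (ha (t - 1)))

end roundCost

/-- The composition of the first `n` stages costs at most its stage cost. -/
theorem cost_chosen_le_stageCost {N : ℕ} {D : ℝ} (hD : 0 ≤ D) {l : Fin N → ℝ}
    (hl : ∀ i, l i ∈ Set.Icc (0 : ℝ) 1) (q q' : ℕ → Fin N) (s : Prop) [Decidable s]
    {a θ g h : ℕ → ℝ} {n : ℕ}
    (ha : ∀ j ≤ n, a j = l (q j) + D * (if s ∧ q j ≠ q' j then 1 else 0)) :
    l (q (chosen θ g n)) + D * (if s ∧ q (chosen θ g n) ≠ q' (chosen θ h n) then 1 else 0) ≤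
      stageCost D a θ g h n := by
  have hpos : ∀ p : Prop, ∀ _ : Decidable p, 0 ≤ D * (if p then (1 : ℝ) else 0) ∧
      D * (if p then (1 : ℝ) else 0) ≤ D := fun p _ => by split_ifs <;> simp [hD]
  induction n with
  | zero => exact (ha 0 le_rfl).ge
  | succ n ih =>
    have ih := ih fun j hj => ha j (hj.trans n.le_succ)
    have han := ha (n + 1) le_rfl
    refine le_min ?_ (add_le_add (hl _).2 (hpos _ _).2)
    by_cases h1 : g n ≤ θ n <;> by_cases h2 : h n ≤ θ n <;>
      simp only [chosen, flag, h1, h2, if_true, if_false, sub_self, mul_zero, add_zero, zero_sub,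
        sub_zero, mul_one, neg_mul_neg]
    · exact ih
    · have h3 := (hpos (s ∧ q (chosen θ g n) ≠ q' (n + 1)) inferInstance).2
      have h4 := (hpos (s ∧ q (chosen θ g n) ≠ q' (chosen θ h n)) inferInstance).1
      linarith
    · have h3 := (hpos (s ∧ q (n + 1) ≠ q' (chosen θ h n)) inferInstance).2
      have h4 := (hpos (s ∧ q (n + 1) ≠ q' (n + 1)) inferInstance).1
      linarith
    · exact han.ge

section combined

variable {N K : ℕ} {Ω : Type*} [MeasurableSpace Ω] (algs : Fin (K + 2) → ExpertAlg N Ω) (D : ℝ)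

/-- The number of the algorithm that the procedure specifies for round `t`. -/
noncomputable def followed (l : ℕ → Fin N → ℝ) (ω : Ω) (ξ : ℕ → unitInterval) (t : ℕ) : ℕ :=
  chosen (fun j => ξ j)
    (gatePair D (floorGate K) (rate K) (agentCost algs D l ω) (fun j => ξ j) t).1 (K + 1)

theorem followed_lt (l : ℕ → Fin N → ℝ) (ω : Ω) (ξ : ℕ → unitInterval) (t : ℕ) :
    followed algs D l ω ξ t < K + 2 :=
  Nat.lt_succ_of_le (chosen_le _ _ _)

theorem choice_eq_followed (hK : 1 ≤ K) (l : ℕ → Fin N → ℝ) (ω : Ω) (ξ : ℕ → unitInterval)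
    (t : ℕ) :
    procedure.choice K D (realizedLoss algs l ω) (realizedSwitch algs l ω) ξ t =
      followed algs D l ω ξ t :=
  (represents_memory K hK D _ _ ξ t).index_one

theorem measurable_play (A : ExpertAlg N Ω) (l : ℕ → Fin N → ℝ) (t : ℕ) :
    Measurable fun ω => A.play l ω t :=
  A.measurable_act _ _

theorem measurable_agentCost (l : ℕ → Fin N → ℝ) (t j : ℕ) :
    Measurable fun ω => agentCost algs D l ω t j := by
  by_cases hj : j < K + 2
  · simp only [agentCost, realizedLoss, realizedSwitch, hj, dif_pos]
    have h := measurable_play (algs ⟨j, hj⟩) l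
    exact ((measurable_of_countable (l t)).comp (h t)).add
      (((measurable_of_countable fun p : Fin N × Fin N =>
        if 0 < t ∧ p.1 ≠ p.2 then (1 : ℝ) else 0).comp ((h t).prodMk (h (t - 1)))).const_mul D)
  · simp [agentCost, realizedLoss, realizedSwitch, hj]

theorem measurable_followed (l : ℕ → Fin N → ℝ) (t : ℕ) :
    Measurable fun x : Ω × (ℕ → unitInterval) => followed algs D l x.1 x.2 t := by
  have hξ : ∀ j, Measurable fun x : Ω × (ℕ → unitInterval) => (x.2 j : ℝ) :=
    fun j => (measurable_seed j).comp measurable_snd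
  exact measurable_chosen hξ (fun j => (measurable_gatePair
    (fun t j => (measurable_agentCost algs D l t j).comp measurable_fst) hξ t j).1) _

/-- The number of the algorithm to follow depends on the losses of earlier rounds only. -/
theorem followed_congr {l l' : ℕ → Fin N → ℝ} (ω : Ω) (ξ : ℕ → unitInterval) (t : ℕ)
    (h : ∀ s < t, l s = l' s) : followed algs D l ω ξ t = followed algs D l' ω ξ t := by
  have hplay : ∀ (A : ExpertAlg N Ω), ∀ s < t, A.play l ω s = A.play l' ω s := fun A s hs => by
    unfold ExpertAlg.play
    congr 2
    ext i
    rw [h i (i.2.trans hs)]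
  unfold followed
  rw [gatePair_congr_cost _ t fun s hs => ?_]
  ext j
  simp only [agentCost, realizedLoss, realizedSwitch]
  by_cases hj : j < K + 2
  · simp only [dif_pos hj, hplay _ s hs, hplay _ (s - 1) (by omega), h s hs]
  · simp only [dif_neg hj]

/-- Losses that agree with `past` before round `t`. -/
def extendPast {t : ℕ} (past : Fin t → Fin N → ℝ) (s : ℕ) : Fin N → ℝ :=
  if h : s < t then past ⟨s, h⟩ else 0

/-- The combination of the algorithms `algs` by the procedure. -/
noncomputable def combined : ExpertAlg N (Ω × (ℕ → unitInterval)) where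
  act t past x :=
    (algs (Fin.ofNat (K + 2) (followed algs D (extendPast past) x.1 x.2 t))).act t past x.1
  measurable_act t past := by
    have h : Measurable fun p : ℕ × Ω => (algs (Fin.ofNat (K + 2) p.1)).act t past p.2 :=
      measurable_from_prod_countable_right fun n =>
        (algs (Fin.ofNat (K + 2) n)).measurable_act t past
    exact h.comp ((measurable_followed algs D (extendPast past) t).prodMk measurable_fst)

theorem combined_play (l : ℕ → Fin N → ℝ) (ω : Ω) (ξ : ℕ → unitInterval) (t : ℕ) :
    (combined algs D).play l (ω, ξ) t =
      (algs (Fin.ofNat (K + 2) (followed algs D l ω ξ t))).play l ω t := by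
  simp only [ExpertAlg.play, combined]
  rw [followed_congr algs D ω ξ t (l' := l) fun s hs => by simp [extendPast, hs]]

variable {D}

theorem agentCost_eq_roundCost (l : ℕ → Fin N → ℝ) (ω : Ω) (t : ℕ) (j : Fin (K + 2)) :
    agentCost algs D l ω t j = roundCost D l ((algs j).play l ω) t := by
  simp [agentCost, realizedLoss, realizedSwitch, roundCost]

theorem agentCost_mem (hD : 0 ≤ D) {l : ℕ → Fin N → ℝ} (hl : ∀ t i, l t i ∈ Set.Icc (0 : ℝ) 1)
    (ω : Ω) (t j : ℕ) : agentCost algs D l ω t j ∈ Set.Icc 0 (1 + D) := by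
  by_cases hj : j < K + 2
  · exact agentCost_eq_roundCost algs l ω t ⟨j, hj⟩ ▸ roundCost_mem hD hl _ t
  · simp only [agentCost, realizedLoss, realizedSwitch, hj, dif_neg, not_false_iff, mul_zero,
      add_zero, Set.mem_Icc, le_refl, true_and]
    positivity

theorem roundCost_combined_le (hD : 0 ≤ D) {l : ℕ → Fin N → ℝ}
    (hl : ∀ t i, l t i ∈ Set.Icc (0 : ℝ) 1) (ω : Ω) (ξ : ℕ → unitInterval) (t : ℕ) :
    roundCost D l ((combined algs D).play l (ω, ξ)) t ≤
      chainCost D (floorGate K) (rate K) (agentCost algs D l ω) t (K + 1) ξ := by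
  have := cost_chosen_le_stageCost hD (hl t)
    (fun j => (algs (Fin.ofNat (K + 2) j)).play l ω t)
    (fun j => (algs (Fin.ofNat (K + 2) j)).play l ω (t - 1)) (0 < t)
    (a := agentCost algs D l ω t) (θ := fun j => ξ j)
    (g := (gatePair D (floorGate K) (rate K) (agentCost algs D l ω) (fun j => ξ j) t).1)
    (h := (gatePair D (floorGate K) (rate K) (agentCost algs D l ω) (fun j => ξ j) t).2)
    (n := K + 1) fun j hj => by
      have hj' : ((Fin.ofNat (K + 2) j : Fin (K + 2)) : ℕ) = j :=
        Nat.mod_eq_of_lt (Nat.lt_succ_of_le hj)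
      have := agentCost_eq_roundCost (D := D) algs l ω t (Fin.ofNat (K + 2) j)
      rw [hj'] at this
      exact this
  rw [gatePair_snd] at this
  refine le_trans (le_of_eq ?_) (this.trans_eq ?_)
  · simp only [roundCost, combined_play]
    rfl
  · rw [chainCost, gatePair_snd]

theorem expectedCost_combined_le (hD : 0 ≤ D) {l : ℕ → Fin N → ℝ}
    (hl : ∀ t i, l t i ∈ Set.Icc (0 : ℝ) 1) (P : Measure Ω) [IsProbabilityMeasure P]
    (A : ExpertAlg N Ω) (t₀ k : ℕ) (R : ℝ)
    (h : ∀ ω, ∫ ξ, ∑ t ∈ Finset.Ico t₀ (t₀ + k), chainCost D (floorGate K) (rate K)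
      (agentCost algs D l ω) t (K + 1) ξ ∂uniformSeeds ≤
        intervalCost D l (A.play l ω) t₀ k + R) :
    (combined algs D).expectedCost (P.prod uniformSeeds) D l t₀ k ≤
      A.expectedCost P D l t₀ k + R := by
  have i1 : Integrable (fun x => intervalCost D l ((combined algs D).play l x) t₀ k)
      (P.prod uniformSeeds) := integrable_of_measurable_of_mem
    (measurable_intervalCost (fun t => measurable_play (combined algs D) l t) t₀ k)
    fun x => intervalCost_mem hD hl _ t₀ k
  have i2 : Integrable (fun ω => intervalCost D l (A.play l ω) t₀ k) P :=
    integrable_of_measurable_of_mem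
    (measurable_intervalCost (fun t => measurable_play A l t) t₀ k)
    fun x => intervalCost_mem hD hl _ t₀ k
  unfold ExpertAlg.expectedCost
  rw [integral_prod _ i1]
  calc _ ≤ ∫ ω, (intervalCost D l (A.play l ω) t₀ k + R) ∂P := by
        refine integral_mono_of_nonneg (.of_forall fun ω => integral_nonneg fun ξ =>
          (intervalCost_mem hD hl _ t₀ k).1) (i2.add (integrable_const R))
          (.of_forall fun ω => le_trans ?_ (h ω))
        refine integral_mono_of_nonneg (.of_forall fun ξ => (intervalCost_mem hD hl _ t₀ k).1)
          (integrable_finsetSum _ fun t _ => integrable_chainCost hD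
            (agentCost_mem algs hD hl ω) t _) (.of_forall fun ξ => ?_)
        exact (intervalCost_le_sum_roundCost hD _ t₀ k).trans
          (Finset.sum_le_sum fun t _ => roundCost_combined_le algs hD hl ω ξ t)
    _ = _ := by
        rw [integral_add i2 (integrable_const R)]
        simp

end combined

/-! ## The regret bounds -/

theorem floorGate_pos (K : ℕ) : 0 < floorGate K := by
  unfold floorGate
  positivity

theorem one_le_two_pow_real (K : ℕ) : (1 : ℝ) ≤ 2 ^ K := one_le_pow₀ (by norm_num)

theorem floorGate_le_one (K : ℕ) : floorGate K ≤ 1 := by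
  have := one_le_two_pow_real K
  rw [floorGate, div_le_one (by positivity)]
  nlinarith

theorem rate_eq (K u : ℕ) : rate K u = 1 / (8 + √(2 ^ K / (K * 2 ^ u) : ℝ)) := by
  rw [rate, Real.sqrt_eq_rpow]

theorem rate_pos (K u : ℕ) : 0 < rate K u := by
  rw [rate_eq]
  positivity

theorem rate_le (K u : ℕ) : rate K u ≤ 1 / 8 := by
  rw [rate_eq]
  exact one_div_le_one_div_of_le (by norm_num)
    (by linarith [Real.sqrt_nonneg (2 ^ K / (K * 2 ^ u) : ℝ)])

theorem succ_le_two_pow (K : ℕ) : (K + 1 : ℝ) ≤ 2 ^ K := by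
  exact_mod_cast Nat.lt_two_pow_self (n := K)

theorem floorGate_mul_le (K : ℕ) {k : ℝ} (hk0 : 0 ≤ k) (hk : k ≤ 2 ^ K) :
    (K + 1) * (2 * floorGate K * k) ≤ 1 / 2 := by
  have h1 := succ_le_two_pow K
  have h2 := one_le_two_pow_real K
  calc (K + 1) * (2 * floorGate K * k) ≤ 2 ^ K * (2 * floorGate K * 2 ^ K) := by
        have := floorGate_pos K
        gcongr
    _ = 1 / 2 := by
        unfold floorGate
        field_simp
        norm_num

theorem sum_sqrt_le (x : ℝ) (hx : 0 ≤ x) (u m : ℕ) :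
    ∑ v ∈ Finset.Ico (u + 1) (u + 1 + m), √(x / 2 ^ v) ≤
      3 * (√(x / 2 ^ u) - √(x / 2 ^ (u + m))) := by
  induction m with
  | zero => simp
  | succ m ih =>
    rw [← add_assoc, Finset.sum_Ico_succ_top (by omega), show u + 1 + m = u + m + 1 by ring,
      show u + (m + 1) = u + m + 1 by ring]
    have h : 4 * √(x / 2 ^ (u + m + 1)) ≤ 3 * √(x / 2 ^ (u + m)) := by
      have h1 : x / 2 ^ (u + m) = 2 * (x / 2 ^ (u + m + 1)) := by
        field_simp
        ring
      rw [h1]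
      refine abs_le_of_sq_le_sq' ?_ (by positivity) |>.2
      rw [mul_pow, mul_pow, Real.sq_sqrt (by positivity), Real.sq_sqrt (by positivity)]
      have : 0 ≤ x / 2 ^ (u + m + 1) := by positivity
      linarith
    rw [show u + m + 1 = u + 1 + m by ring] at *
    linarith

theorem regret_terms_le {K u k : ℕ} (hK : 1 ≤ K) (hu : u ≤ K) (hkK : K ≤ k)
    (hk1 : (2 : ℝ) ^ K / 2 ^ (u + 1) ≤ k) (hk2 : (k : ℝ) ≤ 2 ^ K / 2 ^ u) :
    -Real.log (floorGate K) / rate K u + (8 * rate K u + 2 * floorGate K) * k +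
      ∑ v ∈ Finset.Ico (u + 1) (K + 1), (1 / rate K v + 2 * floorGate K * k) ≤
        60 * √(k * K) := by
  have hK1 : (1 : ℝ) ≤ K := by exact_mod_cast hK
  have hkK' : (K : ℝ) ≤ k := by exact_mod_cast hkK
  set S := √(k * K : ℝ) with hS
  have hS0 : 0 ≤ S := Real.sqrt_nonneg _
  have hSS : S ^ 2 = k * K := Real.sq_sqrt (by positivity)
  set q : ℕ → ℝ := fun v => √(2 ^ K / (K * 2 ^ v) : ℝ) with hq
  have hq0 : ∀ v, 0 ≤ q v := fun v => Real.sqrt_nonneg _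
  have hqq : K * q u ^ 2 = 2 ^ K / 2 ^ u := by
    rw [hq, Real.sq_sqrt (by positivity)]
    field_simp
  have hinv : ∀ v, 1 / rate K v = 8 + q v := fun v => by rw [rate_eq, one_div_one_div]
  have hKS : K ≤ S := by
    refine (abs_le_of_sq_le_sq' ?_ hS0).2
    rw [hSS]
    nlinarith
  have hKq : K * q u ≤ 3 / 2 * S := by
    refine (abs_le_of_sq_le_sq' ?_ (by positivity)).2
    rw [mul_pow, mul_pow, hSS]
    have h1 : (2 : ℝ) ^ K / 2 ^ u ≤ 2 * k := by
      rw [pow_succ, ← div_div] at hk1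
      linarith
    rw [← hqq] at h1
    nlinarith
  have hqS : q u ≤ 3 / 2 * S := le_trans (by nlinarith [hq0 u]) hKq
  have hkSq : k ≤ S * q u := by
    refine (abs_le_of_sq_le_sq' ?_ (by have := hq0 u; positivity)).2
    rw [mul_pow, hSS, mul_assoc, hqq, sq]
    gcongr
  have hlog : -Real.log (floorGate K) ≤ 4 * K := by
    have h2 := Real.log_two_lt_d9
    have : -Real.log (floorGate K) = (2 + 2 * K) * Real.log 2 := by
      rw [floorGate, Real.log_div one_ne_zero (by positivity), Real.log_one,
        Real.log_mul (by norm_num) (by positivity), Real.log_mul (by positivity) (by positivity),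
        Real.log_pow, show (4 : ℝ) = 2 ^ 2 by norm_num, Real.log_pow]
      push_cast
      ring
    rw [this]
    nlinarith
  have h1 : -Real.log (floorGate K) / rate K u ≤ 38 * S := by
    rw [div_eq_mul_one_div, hinv]
    have := mul_le_mul_of_nonneg_right hlog (add_nonneg (by norm_num : (0 : ℝ) ≤ 8) (hq0 u))
    nlinarith
  have h2 : rate K u * k ≤ S := by
    rw [rate_eq, one_div_mul_eq_div, div_le_iff₀ (by positivity)]
    nlinarith
  have h3 : ∑ v ∈ Finset.Ico (u + 1) (K + 1), q v ≤ 9 / 2 * S := by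
    have := sum_sqrt_le (2 ^ K / K) (by positivity) u (K - u)
    rw [show u + 1 + (K - u) = K + 1 by omega] at this
    simp only [div_div] at this
    have h4 := Real.sqrt_nonneg (2 ^ K / (K * 2 ^ (u + (K - u))) : ℝ)
    change _ ≤ 3 * (q u - _) at this
    refine le_trans this ?_
    linarith
  have hkT : (k : ℝ) ≤ 2 ^ K := hk2.trans (div_le_self (by positivity) (one_le_two_pow_real u))
  have h5 := floorGate_mul_le K k.cast_nonneg hkT
  have h6 : ∑ v ∈ Finset.Ico (u + 1) (K + 1), (1 / rate K v + 2 * floorGate K * k) =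
      ((K : ℝ) - u) * (8 + 2 * floorGate K * k) + ∑ v ∈ Finset.Ico (u + 1) (K + 1), q v := by
    simp only [hinv, Finset.sum_add_distrib, Finset.sum_const, Nat.card_Ico, nsmul_eq_mul]
    rw [show K + 1 - (u + 1) = K - u by omega, Nat.cast_sub hu]
    ring
  have h7 : ((K : ℝ) - u) * (8 + 2 * floorGate K * k) ≤ K * (8 + 2 * floorGate K * k) := by
    have := floorGate_pos K
    gcongr
    simp
  rw [h6]
  nlinarith

section regret

variable {N K : ℕ} {Ω : Type*} [MeasurableSpace Ω] (algs : Fin (K + 2) → ExpertAlg N Ω) {D : ℝ}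
  {l : ℕ → Fin N → ℝ} (P : Measure Ω) [IsProbabilityMeasure P]

theorem sqrt_mul_le_two_mul_sqrt_mul_log (K k : ℕ) :
    √(k * K) ≤ 2 * √(k * Real.log (2 ^ K)) := by
  refine Real.sqrt_le_iff.2 ⟨by positivity, ?_⟩
  have h : (0 : ℝ) ≤ k * K := by positivity
  rw [mul_pow, Real.log_pow, Real.sq_sqrt (by positivity)]
  nlinarith [Real.log_two_gt_d9]

theorem expectedCost_combined_le_base (hD : 1 ≤ D) (hl : ∀ t i, l t i ∈ Set.Icc (0 : ℝ) 1) :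
    (combined algs D).expectedCost (P.prod uniformSeeds) D l 0 (2 ^ K) ≤
      (algs 0).expectedCost P D l 0 (2 ^ K) + D := by
  have hD0 : 0 ≤ D := by linarith
  refine expectedCost_combined_le algs hD0 hl P _ _ _ _ fun ω => ?_
  refine (integral_sum_chainCost_le_base hD0 (floorGate_pos K) (floorGate_le_one K) (rate_pos K)
    (rate_le K) (agentCost_mem algs hD0 hl ω) (K + 1) (2 ^ K)).trans ?_
  have h0 : ∀ t, agentCost algs D l ω t 0 = roundCost D l ((algs 0).play l ω) t :=
    fun t => agentCost_eq_roundCost algs l ω t 0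
  rw [intervalCost_zero_eq, Finset.sum_congr rfl fun t _ => h0 t]
  have := floorGate_mul_le K (k := 2 ^ K) (by positivity) le_rfl
  push_cast
  nlinarith

theorem expectedCost_combined_le_expert (hK : 1 ≤ K) (hD : 1 ≤ D)
    (hl : ∀ t i, l t i ∈ Set.Icc (0 : ℝ) 1) (u : Fin (K + 1)) (t₀ k : ℕ)
    (hk1 : (2 : ℝ) ^ K / 2 ^ ((u : ℕ) + 1) ≤ k) (hk2 : (k : ℝ) ≤ 2 ^ K / 2 ^ (u : ℕ)) :
    (combined algs D).expectedCost (P.prod uniformSeeds) D l t₀ k ≤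
      (algs u.succ).expectedCost P D l t₀ k + 1000 * (D * √(k * Real.log (2 ^ K))) := by
  have hD0 : 0 ≤ D := by linarith
  set S := √(k * K : ℝ) with hS
  have hS0 : 0 ≤ S := Real.sqrt_nonneg _
  have hSS : S ^ 2 = k * K := Real.sq_sqrt (by positivity)
  have hlog := mul_le_mul_of_nonneg_left (sqrt_mul_le_two_mul_sqrt_mul_log K k) hD0
  rw [← hS] at hlog
  rcases lt_or_ge k K with hkK | hkK
  · have hkS : (k : ℝ) ≤ S := by
      refine (abs_le_of_sq_le_sq' ?_ hS0).2
      rw [hSS, sq]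
      gcongr
    have h1 : (combined algs D).expectedCost (P.prod uniformSeeds) D l t₀ k ≤ k * (1 + D) := by
      refine (integral_mono_of_nonneg (.of_forall fun x => (intervalCost_mem hD0 hl _ t₀ k).1)
        (integrable_const _) (.of_forall fun x => (intervalCost_mem hD0 hl _ t₀ k).2)).trans_eq ?_
      simp
    have h2 : 0 ≤ (algs u.succ).expectedCost P D l t₀ k :=
      integral_nonneg fun ω => (intervalCost_mem hD0 hl _ t₀ k).1
    have h3 : k * (1 + D) ≤ S * (2 * D) := by
      gcongr
      linarith
    have h4 : 0 ≤ D * √(k * Real.log (2 ^ K)) := mul_nonneg hD0 (Real.sqrt_nonneg _)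
    linarith
  · refine expectedCost_combined_le algs hD0 hl P _ _ _ _ fun ω => ?_
    refine (integral_sum_chainCost_le_expert hD0 (floorGate_pos K) (floorGate_le_one K)
      (rate_pos K) (rate_le K) (agentCost_mem algs hD0 hl ω) u (K + 1) t₀ k (by omega)).trans ?_
    have h0 : ∀ t, agentCost algs D l ω t (u + 1) =
        roundCost D l ((algs u.succ).play l ω) t :=
      fun t => agentCost_eq_roundCost algs l ω t u.succ
    rw [Finset.sum_congr rfl fun t _ => h0 t]
    have h1 := sum_roundCost_le_intervalCost_add (l := l) hD0 ((algs u.succ).play l ω) t₀ k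
    have h2 := regret_terms_le hK (Nat.lt_succ_iff.1 u.2) hkK hk1 hk2
    rw [← hS] at h2
    have h3 := mul_le_mul_of_nonneg_left h2 (by linarith : 0 ≤ 1 + D)
    have hS1 : 1 ≤ S := by
      refine Real.one_le_sqrt.2 ?_
      exact_mod_cast Nat.one_le_iff_ne_zero.2 (Nat.mul_ne_zero (by omega) (by omega))
    have h4 : (1 + D) * (60 * S) ≤ (2 * D) * (60 * S) := by
      gcongr
      linarith
    have h5 : D ≤ D * S := le_mul_of_one_le_right hD0 hS1
    have h6 : 0 ≤ D * √(k * Real.log (2 ^ K)) := mul_nonneg hD0 (Real.sqrt_nonneg _)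
    linarith

end regret

theorem steps_le_log {K n : ℕ} (hK : 1 ≤ K) (h : n ≤ 200 * (K + 1)) :
    (n : ℝ) ≤ 1000 * Real.log (2 ^ K) := by
  rw [Real.log_pow]
  have h1 : (n : ℝ) ≤ 200 * (K + 1) := by exact_mod_cast h
  have h2 : (1 : ℝ) ≤ K := by exact_mod_cast hK
  nlinarith [Real.log_two_gt_d9]

end GateChain

theorem mainTheorem3 :
    ∃ (proc : CombiningProcedure) (C : ℝ), 0 < C ∧
      ∀ (K : ℕ), 1 ≤ K → ∀ (D : ℝ), 1 ≤ D →
      ∀ (N : ℕ) (Ω : Type*) [MeasurableSpace Ω] (P : Measure Ω) [IsProbabilityMeasure P]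
        -- `algs 0` is the base algorithm, `algs u.succ` is the algorithm with index `u`
        (algs : Fin (K + 2) → ExpertAlg N Ω),
      ∃ A : ExpertAlg N (Ω × (ℕ → unitInterval)),
      ∀ (l : ℕ → Fin N → ℝ), (∀ t i, l t i ∈ Set.Icc (0 : ℝ) 1) →
        -- the combined algorithm follows the algorithms specified by the procedure
        (∀ (ω : Ω) (ξ : ℕ → unitInterval) (t : ℕ), t < 2 ^ K →
          ∃ j : Fin (K + 2),
            proc.choice K D (realizedLoss algs l ω) (realizedSwitch algs l ω) ξ t = j ∧
            A.play l (ω, ξ) t = (algs j).play l ω t) ∧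
        -- computational overhead
        (∀ (ω : Ω) (ξ : ℕ → unitInterval),
          (proc.initSteps K D ξ : ℝ) ≤ C * Real.log (2 ^ K) ∧
          ∀ t : ℕ, t < 2 ^ K →
            (proc.roundSteps K D (realizedLoss algs l ω) (realizedSwitch algs l ω) ξ t : ℝ) ≤
              C * Real.log (2 ^ K)) ∧
        -- regret with respect to the algorithm with index `u`, on intervals of matching length
        (∀ (u : Fin (K + 1)) (t₀ k : ℕ), t₀ + k ≤ 2 ^ K →
          (2 : ℝ) ^ K / 2 ^ ((u : ℕ) + 1) ≤ k → (k : ℝ) ≤ (2 : ℝ) ^ K / 2 ^ (u : ℕ) →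
          A.expectedCost (P.prod uniformSeeds) D l t₀ k ≤
            (algs u.succ).expectedCost P D l t₀ k + C * (D * √(k * Real.log (2 ^ K)))) ∧
        -- regret with respect to the base algorithm, over all rounds
        A.expectedCost (P.prod uniformSeeds) D l 0 (2 ^ K) ≤
          (algs 0).expectedCost P D l 0 (2 ^ K) + D := by
  refine ⟨GateChain.procedure, 1000, by norm_num, fun K hK D hD N Ω _ P _ algs =>
    ⟨GateChain.combined algs D, fun l hl => ⟨fun ω ξ t _ => ?_, fun ω ξ => ⟨?_, fun t _ => ?_⟩,
      fun u t₀ k _ hk1 hk2 =>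
        GateChain.expectedCost_combined_le_expert algs P hK hD hl u t₀ k hk1 hk2,
      GateChain.expectedCost_combined_le_base algs P hD hl⟩⟩⟩
  · refine ⟨Fin.ofNat (K + 2) (GateChain.followed algs D l ω ξ t), ?_,
      GateChain.combined_play algs D l ω ξ t⟩
    rw [GateChain.choice_eq_followed algs D hK]
    exact (Nat.mod_eq_of_lt (GateChain.followed_lt algs D l ω ξ t)).symm
  · exact GateChain.steps_le_log hK ((GateChain.initSteps_le K D ξ).trans (by omega))
  · exact GateChain.steps_le_log hK (GateChain.roundSteps_le K hK D _ _ ξ t)
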